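/- **Setting.** Norms are Euclidean. A differentiable $f:\mathbb R^n\to\mathbb R$ is $\alpha$-strongly convex (resp. $\beta$-smooth), $\alpha,\beta>0$, if $f(y)\ge f(x)+\langle\nabla f(x),y-x\rangle+\frac{\alpha}{2}\|y-x\|^2$ (resp. $f(y)\le f(x)+\langle\nabla f(x),y-x\rangle+\frac{\beta}{2}\|y-x\|^2$) for all $x,y\in\mathbb R^n$. $f$ is a monotone transformation of $g$ if $f=\varphi\circ g$ with $\varphi$ strictly increasing on the range of $g$. The condition number of $f$ is the least ratio $\beta/\alpha$ over all $g$ such that $f$ is a monotone transformation of $g$ and $g$ is $\alpha$-strongly convex and $\beta$-smooth. For $A\in\mathbb R^{n\times k}$ with orthonormal columns, $P_A=AA^{\top}$, the restricted condition number $Q_g(A)$ is the least ratio $\beta/\alpha$ over all $\tilde g$ such that $g$ is a monotone transformation of $\tilde g$ and $y\mapsto\tilde g(Ay)$ is $\alpha$-strongly convex and $\beta$-smooth on $\mathbb R^k$. $\mathcal X\subset\mathbb R^n$ is compact with diameter $\|\mathcal X\|$, and $x^*$ is a global minimizer of $f:\mathbb R^n\to\mathbb R$. **GLD-Fast** with parameters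 $T,K,H\in\mathbb N$, a distribution $\mathcal D$ and a starting point $x_0$: put $R=\|\mathcal X\|$. In iteration $t=1,\dots,T$, first replace $R$ by $R/2$ if $H\mid t$; then for $k=-K,\dots,K$ draw independent fresh samples $v_k\sim 2^{-k}R\,\mathcal D$, and let $x_t$ be a minimizer of $f$ among $x_{t-1}$ and the points $x_{t-1}+v_k$ (ties broken by a fixed rule; all of these $2K+2$ evaluations are counted). Return $x_T$. **Theorem.** There are absolute constants $c,C_1,C>0$ such that the following holds for all $Q\ge 2$ and $s\ge 1$, where always $\mathcal D=\mathcal N\big(0,(\tfrac{c}{nQ})^2 I\big)$. 1. (Distance.) Let $f$ have condition number at most $Q$, let $x_0,x^*\in\mathcal X$ and $0<\varepsilon\le\|\mathcal X\|/2$. Run GLD-Fast with $K=\lceil\log_2(4\sqrt Q)\rceil$, $H=\lceil C_1 s\,nQ\log Q\rceil$, $T=HE$, $E=\lceil\log_2(\|\mathcal X\|/\varepsilon)\rceil$. Then it makes at most $C s\,nQ\log^2(Q)\log(\|\mathcal X\|/\varepsilon)$ function evaluations, and with probability at least $1-E\,e^{-s\,nQ\log Q}$ we have $\|x_T-x^*\|\le\varepsilon$.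 2. (Function value.) If in addition $f$ itself is $\beta$-smooth and now $0<\varepsilon\le\beta\|\mathcal X\|^2/2$ and $E=\lceil\log_2(\beta\|\mathcal X\|^2/\varepsilon)\rceil$ (with $K$, $H$, $T=HE$ as before), then it makes at most $C s\,nQ\log^2(Q)\log(\beta\|\mathcal X\|^2/\varepsilon)$ evaluations, and with probability at least $1-E\,e^{-s\,nQ\log Q}$ we have $f(x_T)-f(x^*)\le\varepsilon$. 3. (Low rank.) Let $1\le k<n$, let $A\in\mathbb R^{n\times k}$ have orthonormal columns, $f(x)=g(P_Ax)$ with $Q_g(A)\le Q$, $x_0,x^*\in\mathcal X$, $0<\varepsilon\le\|\mathcal X\|/2$. Run GLD-Fast with $K=\lceil\log_2(4n\sqrt Q)\rceil$, $H=\lceil C_1 s\,kQ\log Q\rceil$, $T=HE$, $E=\lceil\log_2(\|\mathcal X\|/\varepsilon)\rceil$. Then it makes at most $C s\,kQ\log(n)\log^2(Q)\log(\|\mathcal X\|/\varepsilon)$ evaluations, and with probability at least $1-E\,e^{-s\,kQ\log Q}$ we have $\|P_A(x_T-x^*)\|\le\varepsilon$. 4. (Almost low rank.) Let $k,A$ be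 as in 3 and $f(x)=g(P_Ax)+h(x)$ with $h$ measurable, $|h|\le\delta$, $Q_g(A)\le Q$, where $y\mapsto g(Ay)$ is convex and $\beta$-smooth, and let $\mathcal X$ contain $x_0$ and a minimizer of $g\circ P_A$. Let $60\,\delta kQ<\varepsilon\le\beta\|\mathcal X\|^2/2$. Run GLD-Fast with $K$, $H$ as in 3, $T=HE$, $E=\lceil\log_2(\beta\|\mathcal X\|^2/\varepsilon)\rceil$. Then it makes at most $C s\,kQ\log(n)\log^2(Q)\log(\beta\|\mathcal X\|^2/\varepsilon)$ evaluations, and with probability at least $1-E\,e^{-s\,kQ\log Q}$ we have $f(x_T)-f(x^*)\le\varepsilon$ and, for every $\alpha>0$ such that $y\mapsto g(Ay)$ is $\alpha$-strongly convex, $\|P_A(x_T-x^*)\|^2\le 4\varepsilon/\alpha$. (Taking $s=1$ gives the evaluation counts $O(nQ\log^2(Q)\log(\|\mathcal X\|/\varepsilon))$ and $O(kQ\log(n)\log^2(Q)\log(\|\mathcal X\|/\varepsilon))$; a larger $s$ makes the failure probability as small as desired.) -/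

import Mathlib

open MeasureTheory ProbabilityTheory Set

universe u

noncomputable section

/-- `EuclideanSpace ℝ (Fin n)`, that is, `ℝⁿ` with the Euclidean norm. -/
abbrev Eu (n : ℕ) : Type := EuclideanSpace ℝ (Fin n)

/-! ### Condition numbers -/

/-- `α`-strong convexity on `ℝⁿ`, in its first-order form. -/
def IsStronglyConvex {n : ℕ} (α : ℝ) (f : Eu n → ℝ) : Prop :=
  Differentiable ℝ f ∧
    ∀ x y, f x + inner ℝ (gradient f x) (y - x) + α / 2 * ‖y - x‖ ^ 2 ≤ f y

/-- `β`-smoothness on `ℝⁿ`. -/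
def IsSmooth {n : ℕ} (β : ℝ) (f : Eu n → ℝ) : Prop :=
  Differentiable ℝ f ∧
    ∀ x y, f y ≤ f x + inner ℝ (gradient f x) (y - x) + β / 2 * ‖y - x‖ ^ 2

/-- `f` is a monotone transformation of `g`: `f = φ ∘ g` for some function `φ` that is strictly
increasing on the range of `g`. -/
def IsMonotoneTransformation {E : Type*} (f g : E → ℝ) : Prop :=
  ∃ φ : ℝ → ℝ, StrictMonoOn φ (range g) ∧ f = φ ∘ g

/-- The ratios `β / α` over all `g` such that `f` is a monotone transformation of `g` and `g` is
`α`-strongly convex and `β`-smooth.  The condition number of `f` is the least of them. -/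
def conditionRatios {n : ℕ} (f : Eu n → ℝ) : Set ℝ :=
  {q | ∃ (g : Eu n → ℝ) (α β : ℝ), 0 < α ∧ 0 < β ∧ IsMonotoneTransformation f g ∧
    IsStronglyConvex α g ∧ IsSmooth β g ∧ q = β / α}

/-- The condition number of `f` is at most `Q`. -/
def ConditionNumberLE {n : ℕ} (f : Eu n → ℝ) (Q : ℝ) : Prop :=
  ∃ q ∈ conditionRatios f, q ≤ Q

/-- An orthonormal `n × k` matrix `A` is a linear isometry `ℝᵏ → ℝⁿ`.  The ratios `β / α` over all
`g` such that `f` is a monotone transformation of `g` and `y ↦ g (A y)` is `α`-strongly convex and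
`β`-smooth.  The condition number of `f` restricted to `A` is the least of them. -/
def restrictedConditionRatios {n k : ℕ} (A : Eu k →ₗᵢ[ℝ] Eu n) (f : Eu n → ℝ) : Set ℝ :=
  {q | ∃ (g : Eu n → ℝ) (α β : ℝ), 0 < α ∧ 0 < β ∧ IsMonotoneTransformation f g ∧
    IsStronglyConvex α (fun y => g (A y)) ∧ IsSmooth β (fun y => g (A y)) ∧ q = β / α}

/-- The condition number of `f` restricted to `A` is at most `Q`. -/
def RestrictedConditionNumberLE {n k : ℕ} (A : Eu k →ₗᵢ[ℝ] Eu n) (f : Eu n → ℝ) (Q : ℝ) : Prop :=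
  ∃ q ∈ restrictedConditionRatios A f, q ≤ Q

/-- The projection `P_A = A Aᵀ` onto the column space of `A`. -/
def projA {n k : ℕ} (A : Eu k →ₗᵢ[ℝ] Eu n) (x : Eu n) : Eu n :=
  A (ContinuousLinearMap.adjoint A.toContinuousLinearMap x)

/-! ### The algorithm GLD-Fast -/

/-- The search radius `R` in iteration `t ≥ 1`: it starts at `R₀` and is halved in every iteration
whose number is divisible by `H`. -/
def gldRadius (R₀ : ℝ) (H t : ℕ) : ℝ := R₀ / 2 ^ (t / H)

/-- The list of the points that one iteration compares, from the current point `x` with search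
radius `R`: first `x` itself, then `x + r_k • v k` for `k = -K, …, K`, where `r_k = 2 ^ (-k) * R`
and `v k` is a sample of the distribution `𝒟`. -/
def gldCandidates {n : ℕ} (K : ℕ) (R : ℝ) (v : ℤ → Eu n) (x : Eu n) : List (Eu n) :=
  x :: (List.range (2 * K + 1)).map fun i =>
    x + ((2 : ℝ) ^ (-((i : ℤ) - (K : ℤ))) * R) • v ((i : ℤ) - (K : ℤ))

/-- A state of the algorithm: the current point and the number of evaluations of the objective
that were made so far. -/
structure GLDState (n : ℕ) where
  point : Eu n
  evals : ℕ

/-- GLD-Fast after `t` iterations, on the objective `f` from the starting point `x₀`; `v t k` is the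
sample of `𝒟` that is drawn in iteration `t` for the radius number `k`.  Each iteration evaluates
`f` at every candidate and moves to a candidate with the least value. -/
def gldFast {n : ℕ} (f : Eu n → ℝ) (K H : ℕ) (R₀ : ℝ) (x₀ : Eu n) (v : ℕ → ℤ → Eu n) :
    ℕ → GLDState n
  | 0 => ⟨x₀, 0⟩
  | t + 1 =>
    let s := gldFast f K H R₀ x₀ v t
    let c := gldCandidates K (gldRadius R₀ H (t + 1)) (v (t + 1)) s.point
    ⟨(c.argmin f).getD s.point, s.evals + c.length⟩

/-- The samples `w t k` (iteration `t`, radius number `k`) are independent, each with the law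
`𝒩(0, σ² I)`. -/
structure IsGaussianSampling {n : ℕ} {Ω : Type u} [MeasurableSpace Ω] (μ : Measure Ω) (σ : ℝ)
    (w : ℕ → ℤ → Ω → Eu n) : Prop where
  measurable : ∀ t k, Measurable (w t k)
  law : ∀ t k, μ.map (w t k) = (stdGaussian (Eu n)).map (fun z => σ • z)
  indep : iIndepFun (fun (p : ℕ × ℤ) => w p.1 p.2) μ

/-- The sweep half-width `K = ⌈log₂ (4 √Q)⌉`. -/
def gldSweep (Q : ℝ) : ℕ := ⌈Real.logb 2 (4 * Real.sqrt Q)⌉₊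

/-- The sweep half-width `K = ⌈log₂ (4 n √Q)⌉`, used when the latent dimension is unknown. -/
def gldSweepLowRank (n : ℕ) (Q : ℝ) : ℕ := ⌈Real.logb 2 (4 * n * Real.sqrt Q)⌉₊

/-- The epoch length `H = ⌈C s d Q log Q⌉`. -/
def gldEpoch (C s : ℝ) (d : ℕ) (Q : ℝ) : ℕ := ⌈C * s * d * Q * Real.log Q⌉₊

/-- The number of epochs `⌈log₂ a⌉`. -/
def gldNumEpochs (a : ℝ) : ℕ := ⌈Real.logb 2 a⌉₊

end

/-! Progress is measured by the gap of the well-conditioned representative `Gt` (α-strongly convex,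
αQ-smooth) in the coordinates Aᵀx. A Gaussian on ℝⁿ projects to a Gaussian on ℝᵏ, so only k matters.
At distance D from the minimizer, a sample of scale about D/(kQ) has, with at least a constant
probability, a moderate component along the negative gradient and an orthogonal part of order √k;
such a step multiplies the gap by at most 1 - 1/(10kQ) (`stretched_step_le`). During an epoch of
radius R, as long as its goal is not reached, R²/(4Q) < D² ≤ 4QR², so the sweep contains a suitable
scale (`exists_scale`).

Noise is handled by a margin: the decrease survives stretching the new point away from the minimizer
by 1 + 1/(25kQ). By convexity along rays, the stretched point dominates every point that the noise
could confuse with the new one, unless that point lies under the noise floor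
(`gap_le_of_stretched`). Hence `levelGap`, the largest gap compatible with the observed value,
shrinks by the same factor.

The potential is `levelGap` to the power 10kQ, and 0 once the goal or the noise floor is reached. A
success multiplies it by at most e⁻¹ and a failure does not raise it, so its expectation falls by a
constant factor per iteration. It starts an epoch at no more than (2αQ²R²)^(10kQ) and is at least
(αR²/8)^(10kQ) while active, so Markov's inequality bounds the failure of an epoch
(`measure_epoch_le`). A successful epoch ends at a level that is an admissible start for radius R/2,
and a union bound over the epochs finishes (`prob_settled`).

The exact cases take δ = 0 and G = `Gt`, with A the identity for full rank; the almost low-rank case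
takes G = g ∘ A. -/

/-! ### Gaussian samples and the probability of a good one. -/

/-- The adjoint of a linear isometry maps the standard Gaussian to the standard Gaussian. -/
lemma stdGaussian_map_adjoint {n k : ℕ} (A : Eu k →ₗᵢ[ℝ] Eu n) :
    (stdGaussian (Eu n)).map (ContinuousLinearMap.adjoint A.toContinuousLinearMap) =
      stdGaussian (Eu k) := by
  have : IsProbabilityMeasure
      ((stdGaussian (Eu n)).map (ContinuousLinearMap.adjoint A.toContinuousLinearMap)) :=
    Measure.isProbabilityMeasure_map (by fun_prop)
  apply Measure.ext_of_charFun
  ext t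
  have h : charFun ((stdGaussian (Eu n)).map
      (ContinuousLinearMap.adjoint A.toContinuousLinearMap)) t =
      charFun (stdGaussian (Eu n)) (A t) := by
    rw [charFun_apply, charFun_apply, integral_map (by fun_prop) (by fun_prop)]
    simp [ContinuousLinearMap.adjoint_inner_left]
  rw [h, charFun_stdGaussian, charFun_stdGaussian, A.norm_map]

lemma stdGaussian_map_inner {k : ℕ} (e : Eu k) (he : ‖e‖ = 1) :
    (stdGaussian (Eu k)).map (fun z => inner ℝ e z) = gaussianReal 0 1 := by
  have h := IsGaussian.map_eq_gaussianReal (μ := stdGaussian (Eu k)) (innerSL ℝ e)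
  rw [integral_strongDual_stdGaussian, variance_dual_stdGaussian, innerSL_apply_norm, he] at h
  have e1 : (1 ^ 2 : ℝ).toNNReal = 1 := by simp
  rw [e1] at h
  exact h

lemma lintegral_norm_sq_stdGaussian (k : ℕ) :
    ∫⁻ z, ENNReal.ofReal (‖z‖ ^ 2) ∂(stdGaussian (Eu k)) = k := by
  have h1 : ∀ z : Eu k, ENNReal.ofReal (‖z‖ ^ 2) = ∑ i : Fin k, ENNReal.ofReal
      ((inner ℝ (EuclideanSpace.basisFun (Fin k) ℝ i) z) ^ 2) := by
    intro z
    rw [← ENNReal.ofReal_sum_of_nonneg (fun i _ => sq_nonneg _),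
      (EuclideanSpace.basisFun (Fin k) ℝ).sum_sq_inner_right]
  simp_rw [h1]
  rw [lintegral_finsetSum _ (fun i _ => by fun_prop)]
  have h2 : ∀ i : Fin k, ∫⁻ z, ENNReal.ofReal
      ((inner ℝ (EuclideanSpace.basisFun (Fin k) ℝ i) z) ^ 2) ∂(stdGaussian (Eu k)) = 1 := by
    intro i
    rw [← lintegral_map (μ := stdGaussian (Eu k)) (f := fun x : ℝ => ENNReal.ofReal (x ^ 2))
      (g := fun z => inner ℝ (EuclideanSpace.basisFun (Fin k) ℝ i) z) (by fun_prop) (by fun_prop),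
      stdGaussian_map_inner _ ((EuclideanSpace.basisFun (Fin k) ℝ).norm_eq_one i),
      ← ofReal_integral_eq_lintegral_ofReal]
    · have := variance_of_integral_eq_zero (X := id) (μ := gaussianReal 0 1)
        aemeasurable_id (by simp)
      rw [variance_id_gaussianReal] at this
      simp only [id] at this
      rw [← this]; simp
    · exact (memLp_id_gaussianReal 2).integrable_sq
    · filter_upwards with x using sq_nonneg x
  rw [Finset.sum_congr rfl fun i _ => h2 i]
  simp

/-- The direction component and the orthogonal component of a standard Gaussian vector are
independent. -/
lemma indepFun_inner_sub_stdGaussian {k : ℕ} (e : Eu k) (he : ‖e‖ = 1) :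
    IndepFun (fun z : Eu k => inner ℝ e z) (fun z => z - inner ℝ e z • e)
      (stdGaussian (Eu k)) := by
  have h0 : HasGaussianLaw (id : Eu k → Eu k) (stdGaussian (Eu k)) :=
    IsGaussian.hasGaussianLaw_id
  have hj : HasGaussianLaw (fun z : Eu k => (inner ℝ e z, z - inner ℝ e z • e))
      (stdGaussian (Eu k)) :=
    h0.map_fun ((innerSL ℝ e).prod (ContinuousLinearMap.id ℝ (Eu k) -
      (innerSL ℝ e).smulRight e))
  -- Jointly Gaussian variables are independent once their cross-covariance vanishes; here it is an
  -- inner product of a multiple of e with a vector orthogonal to e.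
  refine hj.indepFun_of_covariance_inner fun x y => ?_
  have e1 : (fun z : Eu k => inner ℝ x (inner ℝ e z)) = fun z => inner ℝ (x • e) z := by
    ext z; simp [inner_smul_left, mul_comm]
  have e2 : (fun z : Eu k => inner ℝ y (z - inner ℝ e z • e)) =
      fun z => inner ℝ (y - inner ℝ y e • e) z := by
    ext z; simp [inner_sub_left, inner_sub_right, inner_smul_left, inner_smul_right, mul_comm]
  rw [e1, e2, ← covarianceBilin_apply_eq_cov IsGaussian.memLp_two_id,
    covarianceBilin_stdGaussian]
  change inner ℝ (x • e) (y - inner ℝ y e • e) = 0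
  rw [inner_smul_left, inner_sub_right, inner_smul_right, real_inner_self_eq_norm_sq, he,
    real_inner_comm]
  simp

/-- A lower bound for the probability of a successful Gaussian step. -/
noncomputable def gaussianSuccess : ENNReal := gaussianReal 0 1 (Icc 10 20) / 2

lemma gaussianSuccess_pos : 0 < gaussianSuccess := by
  have : gaussianReal 0 1 (Icc 10 20) ≠ 0 := fun h => by
    have := gaussianReal_absolutelyContinuous' 0 (one_ne_zero) h
    rw [Real.volume_Icc] at this
    norm_num at this
  exact ENNReal.div_pos this (by norm_num)

lemma gaussianSuccess_le_one : gaussianSuccess ≤ 1 :=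
  (ENNReal.div_le_of_le_mul (prob_le_one.trans (by norm_num)))

/-- The samples that have a moderate component along `e` and a short orthogonal component. -/
def goodSamples {k : ℕ} (e : Eu k) : Set (Eu k) :=
  {z | inner ℝ e z ∈ Icc (10 : ℝ) 20 ∧ ‖z - inner ℝ e z • e‖ ^ 2 ≤ 2 * k}

lemma measurableSet_goodSamples {k : ℕ} (e : Eu k) : MeasurableSet (goodSamples e) := by
  refine MeasurableSet.inter ?_ ?_
  · exact measurableSet_preimage (f := fun z : Eu k => inner ℝ e z) (by fun_prop)
      measurableSet_Icc
  · exact measurableSet_le (f := fun z : Eu k => ‖z - inner ℝ e z • e‖ ^ 2) (by fun_prop)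
      measurable_const

lemma norm_sub_inner_smul_sq_le {k : ℕ} (e z : Eu k) (he : ‖e‖ = 1) :
    ‖z - inner ℝ e z • e‖ ^ 2 ≤ ‖z‖ ^ 2 := by
  rw [norm_sub_sq_real, inner_smul_right, norm_smul, he, real_inner_comm]
  simp only [Real.norm_eq_abs, mul_one, sq_abs]
  nlinarith [sq_nonneg (inner ℝ z e : ℝ)]

/-- The two conditions concern independent components, so the probabilities multiply. The orthogonal
part is no longer than z and E‖z‖² = k, so by Markov at level 2k it costs at most the factor 1/2,
whatever k is. -/
lemma gaussianSuccess_le {k : ℕ} (hk : 1 ≤ k) (e : Eu k) (he : ‖e‖ = 1) :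
    gaussianSuccess ≤ stdGaussian (Eu k) (goodSamples e) := by
  set P := stdGaussian (Eu k)
  have hkpos : (0 : ℝ) < 2 * k := by positivity
  have hind := (indepFun_inner_sub_stdGaussian e he).measure_inter_preimage_eq_mul
    (Icc 10 20) {y | ‖y‖ ^ 2 ≤ 2 * k} measurableSet_Icc
    (measurableSet_le (continuous_norm.pow 2).measurable measurable_const)
  have h1 : P ((fun z : Eu k => inner ℝ e z) ⁻¹' Icc 10 20) = gaussianReal 0 1 (Icc 10 20) := by
    rw [← stdGaussian_map_inner e he, Measure.map_apply (by fun_prop) measurableSet_Icc]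
  have hS : MeasurableSet ((fun z : Eu k => z - inner ℝ e z • e) ⁻¹' {y | ‖y‖ ^ 2 ≤ 2 * k}) :=
    measurableSet_preimage (by fun_prop) (measurableSet_le (by fun_prop) (by fun_prop))
  have h2 : P ((fun z : Eu k => z - inner ℝ e z • e) ⁻¹' {y | ‖y‖ ^ 2 ≤ 2 * k})ᶜ ≤ 2⁻¹ := by
    have hm := mul_meas_ge_le_lintegral (μ := P) (f := fun z : Eu k => ENNReal.ofReal (‖z‖ ^ 2))
      (by fun_prop) (ENNReal.ofReal (2 * k))
    rw [lintegral_norm_sq_stdGaussian] at hm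
    have hsub : ((fun z : Eu k => z - inner ℝ e z • e) ⁻¹' {y | ‖y‖ ^ 2 ≤ 2 * k})ᶜ ⊆
        {z | ENNReal.ofReal (2 * k) ≤ ENNReal.ofReal (‖z‖ ^ 2)} := by
      intro z hz
      simp only [mem_compl_iff, mem_preimage, mem_ofPred_eq, not_le] at hz
      exact ENNReal.ofReal_le_ofReal (hz.le.trans (norm_sub_inner_smul_sq_le e z he))
    refine (measure_mono hsub).trans ?_
    have hk2 : ENNReal.ofReal (2 * k) = 2 * k := by
      rw [ENNReal.ofReal_mul (by norm_num)]; simp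
    rw [hk2] at hm ⊢
    have hk0 : (k : ENNReal) ≠ 0 := by simp; omega
    have hkt : (k : ENNReal) ≠ ⊤ := by simp
    rw [ENNReal.le_inv_iff_mul_le]
    refine (ENNReal.mul_le_mul_iff_right hk0 hkt).1 ?_
    calc _ = 2 * k * P _ := by ring
      _ ≤ k * 1 := by rw [mul_one]; exact hm
  have h3 : 2⁻¹ ≤ P ((fun z : Eu k => z - inner ℝ e z • e) ⁻¹' {y | ‖y‖ ^ 2 ≤ 2 * k}) := by
    have := prob_add_prob_compl (μ := P) hS
    by_contra! hlt
    have : (1 : ENNReal) < 1 := by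
      calc (1 : ENNReal) = _ := this.symm
        _ < 2⁻¹ + 2⁻¹ := ENNReal.add_lt_add_of_lt_of_le (by simp) hlt h2
        _ = 1 := ENNReal.inv_two_add_inv_two
    exact lt_irrefl _ this
  calc gaussianSuccess = gaussianReal 0 1 (Icc 10 20) * 2⁻¹ := by
        rw [gaussianSuccess, div_eq_mul_inv]
    _ ≤ P ((fun z : Eu k => inner ℝ e z) ⁻¹' Icc 10 20) *
        P ((fun z : Eu k => z - inner ℝ e z • e) ⁻¹' {y | ‖y‖ ^ 2 ≤ 2 * k}) := by
        rw [h1]; gcongr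
    _ = _ := hind.symm

/-! ### Gradient inequalities and the effect of one good step. -/

section Deterministic

variable {k : ℕ} {G : Eu k → ℝ} {ystar : Eu k}

lemma gradient_eq_zero_of_isMin (hmin : ∀ y, G ystar ≤ G y) : gradient G ystar = 0 := by
  have h : IsLocalMin G ystar := Filter.Eventually.of_forall hmin
  simp [gradient, h.fderiv_eq_zero]

lemma IsSmooth.sub_min_le {β : ℝ} (hG : IsSmooth β G) (hmin : ∀ y, G ystar ≤ G y) (y : Eu k) :
    G y - G ystar ≤ β / 2 * ‖y - ystar‖ ^ 2 := by
  have := hG.2 ystar y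
  rw [gradient_eq_zero_of_isMin hmin, inner_zero_left] at this
  linarith

lemma IsStronglyConvex.le_sub_min {α : ℝ} (hG : IsStronglyConvex α G)
    (hmin : ∀ y, G ystar ≤ G y) (y : Eu k) :
    α / 2 * ‖y - ystar‖ ^ 2 ≤ G y - G ystar := by
  have := hG.2 ystar y
  rw [gradient_eq_zero_of_isMin hmin, inner_zero_left] at this
  linarith

/-- Strongly convex functions are convex along rays. -/
lemma IsStronglyConvex.ray_le {α : ℝ} (hα : 0 ≤ α) (hG : IsStronglyConvex α G) (a y : Eu k)
    {t : ℝ} (ht0 : 0 ≤ t) (ht1 : t ≤ 1) :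
    G (a + t • (y - a)) - G a ≤ t * (G y - G a) := by
  set w := a + t • (y - a) with hw
  have h1 := hG.2 w y
  have h2 := hG.2 w a
  have e1 : y - w = (1 - t) • (y - a) := by rw [hw]; module
  have e2 : a - w = (-t) • (y - a) := by rw [hw]; module
  rw [e1, inner_smul_right] at h1
  rw [e2, inner_smul_right] at h2
  set p : ℝ := inner ℝ (gradient G w) (y - a)
  have h1' : G w + (1 - t) * p ≤ G y := by
    have : 0 ≤ α / 2 * ‖(1 - t) • (y - a)‖ ^ 2 := by positivity
    linarith
  have h2' : G w + -t * p ≤ G a := by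
    have : 0 ≤ α / 2 * ‖(-t) • (y - a)‖ ^ 2 := by positivity
    linarith
  -- The tangent plane at w lies below the graph at y and at a; the weights t and 1 - t cancel the
  -- slope p.
  nlinarith [mul_le_mul_of_nonneg_left h1' ht0, mul_le_mul_of_nonneg_left h2' (sub_nonneg.2 ht1)]

/-- A numerical inequality behind the progress of a successful step. -/
lemma step_numeric {τ : ℝ} (h0 : 1 / 4 ≤ τ) (h1 : τ ≤ 1) :
    1 / 10 ≤ τ - 1 / 25 - ((51 / 50) * (τ + 3 / 40) + 1 / 25) ^ 2 / 2 := by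
  -- The right side is a concave quadratic in τ, so the endpoints 1/4 and 1 decide.
  nlinarith [mul_nonneg (sub_nonneg.2 h0) (sub_nonneg.2 h1)]

set_option maxHeartbeats 400000 in
/-- A step that leads to a sample in `goodSamples`, at the right scale, decreases the gap, even
after it is stretched away from the minimizer. -/
lemma stretched_step_le {α Q : ℝ} (hα : 0 < α) (hQ : 2 ≤ Q) (hk : 1 ≤ k)
    (hc : IsStronglyConvex α G) (hs : IsSmooth (α * Q) G) (hmin : ∀ y, G ystar ≤ G y)
    {y : Eu k} (hy : y ≠ ystar) {z : Eu k}
    (hz : z ∈ goodSamples (-(‖gradient G y‖⁻¹ • gradient G y))) {r : ℝ}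
    (hr0 : ‖y - ystar‖ / 2 ≤ r) (hr1 : r ≤ ‖y - ystar‖) :
    G (ystar + (1 + 1 / (25 * (k * Q))) • (y + (r * (1 / 20) / (k * Q)) • z - ystar)) - G ystar ≤
      (1 - 1 / (10 * (k * Q))) * (G y - G ystar) := by
  have hk1 : (1 : ℝ) ≤ k := by exact_mod_cast hk
  set D := ‖y - ystar‖ with hD
  have hDpos : 0 < D := norm_pos_iff.2 (sub_ne_zero.2 hy)
  set g := gradient G y with hg
  set gap := G y - G ystar with hgap
  have hkQ : 2 ≤ k * Q := by nlinarith only [hk1, hQ]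
  have hkQ0 : 0 < k * Q := by linarith
  -- bounds for the gradient
  have hlow : gap + α / 2 * D ^ 2 ≤ inner ℝ g (y - ystar) := by
    have := hc.2 y ystar
    have e : ystar - y = -(y - ystar) := by abel
    rw [e, inner_neg_right, norm_neg] at this
    linarith
  have hgapD : α / 2 * D ^ 2 ≤ gap := hc.le_sub_min hmin y
  have hCS : inner ℝ g (y - ystar) ≤ ‖g‖ * D := real_inner_le_norm _ _
  have hgD : α * D ≤ ‖g‖ := by
    have : α * D * D ≤ ‖g‖ * D := by linarith [mul_assoc α D D, sq D, hlow, hCS, hgapD]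
    exact le_of_mul_le_mul_right this hDpos
  have hgpos : 0 < ‖g‖ := lt_of_lt_of_le (by positivity) hgD
  have hgapg : gap ≤ ‖g‖ * D := by
    have : 0 ≤ α / 2 * D ^ 2 := by positivity
    linarith
  -- decomposition of the sample
  set e := -(‖g‖⁻¹ • g) with he
  obtain ⟨⟨hζ0, hζ1⟩, hN⟩ := hz
  set ζ : ℝ := inner ℝ e z with hζ
  have henorm : ‖e‖ = 1 := by
    rw [he, norm_neg, norm_smul, norm_inv, norm_norm, inv_mul_cancel₀ hgpos.ne']
  have hgz : inner ℝ g z = -(‖g‖ * ζ) := by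
    rw [hζ, he, inner_neg_left, inner_smul_left]
    simp only [conj_trivial]
    field_simp
  -- Lengths are in units of ρ: with u = r/D in [1/2, 1] and ζ in [10, 20], the advance τ = uζ/20
  -- lies in [1/4, 1], which is what the sampling constant 1/20 is for. The stretch costs only θD =
  -- ρ/25.
  set ρ := D / (k * Q) with hρ
  have hρpos : 0 < ρ := by positivity
  set u := r / D with hu
  have hu0 : 1 / 2 ≤ u := by rw [hu, le_div_iff₀ hDpos]; linarith
  have hu1 : u ≤ 1 := by rw [hu, div_le_one hDpos]; exact hr1
  have hcoef : r * (1 / 20) / (k * Q) = ρ * (u / 20) := by rw [hρ, hu]; field_simp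
  set θ : ℝ := 1 / (25 * (k * Q)) with hθ
  have hθ0 : 0 < θ := by positivity
  have hθ1 : θ ≤ 1 / 50 := by
    rw [hθ]; apply one_div_le_one_div_of_le <;> linarith
  have hθD : θ * D = ρ * (1 / 25) := by rw [hθ, hρ]; field_simp
  set τ := u * ζ / 20 with hτ
  have hτ0 : 1 / 4 ≤ τ := by
    have := mul_le_mul hu0 hζ0 (by norm_num) (by linarith)
    linarith
  have hτ1 : τ ≤ 1 := by
    have := mul_le_mul hu1 hζ1 (by linarith) (by norm_num)
    linarith
  rw [hcoef]
  set w := ystar + (1 + θ) • (y + (ρ * (u / 20)) • z - ystar) with hw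
  have hwy : w - y = ((1 + θ) * (ρ * (u / 20))) • z + θ • (y - ystar) := by
    rw [hw]; module
  -- the first-order term
  have hfirst : inner ℝ g (w - y) ≤ -(ρ * ‖g‖ * (τ - 1 / 25)) := by
    rw [hwy, inner_add_right, inner_smul_right, inner_smul_right, hgz]
    have h1 : θ * inner ℝ g (y - ystar) ≤ ρ * (1 / 25) * ‖g‖ := by
      calc θ * inner ℝ g (y - ystar) ≤ θ * (‖g‖ * D) := by gcongr
        _ = ρ * (1 / 25) * ‖g‖ := by rw [← hθD]; ring
    have h2 : ρ * ‖g‖ * τ ≤ (1 + θ) * (ρ * (u / 20)) * (‖g‖ * ζ) := by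
      have : (1 + θ) * (ρ * (u / 20)) * (‖g‖ * ζ) = (1 + θ) * (ρ * ‖g‖ * τ) := by
        rw [hτ]; ring
      rw [this]
      have : 0 ≤ θ * (ρ * ‖g‖ * τ) := by positivity
      linarith
    linarith
  -- the second-order term
  have hsqk : (1 : ℝ) ≤ Real.sqrt k := Real.one_le_sqrt.2 hk1
  -- √2 ≤ 3/2; times 1/20 this is the 3/40 in m.
  have hNnorm : ‖z - ζ • e‖ ≤ 3 / 2 * Real.sqrt k := by
    apply le_of_sq_le_sq _ (by positivity)
    rw [mul_pow, Real.sq_sqrt (by positivity)]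
    linarith
  have hznorm : ‖z‖ ≤ ζ + 3 / 2 * Real.sqrt k := by
    have : z = ζ • e + (z - ζ • e) := by abel
    calc ‖z‖ = ‖ζ • e + (z - ζ • e)‖ := by rw [← this]
      _ ≤ ‖ζ • e‖ + ‖z - ζ • e‖ := norm_add_le _ _
      _ ≤ ζ + 3 / 2 * Real.sqrt k := by
        rw [norm_smul, henorm, Real.norm_eq_abs, abs_of_nonneg (by linarith)]; linarith
  set m := (51 / 50) * (τ + 3 / 40) + 1 / 25 with hm
  have hmpos : 0 < m := by rw [hm]; linarith
  have hwnorm : ‖w - y‖ ≤ ρ * (Real.sqrt k * m) := by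
    rw [hwy]
    calc _ ≤ ‖((1 + θ) * (ρ * (u / 20))) • z‖ + ‖θ • (y - ystar)‖ := norm_add_le _ _
      _ = (1 + θ) * (ρ * (u / 20)) * ‖z‖ + θ * D := by
        rw [norm_smul, norm_smul, Real.norm_of_nonneg (by positivity),
          Real.norm_of_nonneg (by positivity)]
      _ ≤ (51 / 50) * (ρ * (u / 20)) * (ζ + 3 / 2 * Real.sqrt k) + ρ * (1 / 25) := by
        rw [hθD]; gcongr; linarith
      _ = ρ * ((51 / 50) * (τ + 3 / 40 * (u * Real.sqrt k)) + 1 / 25) := by rw [hτ]; ring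
      _ ≤ ρ * (Real.sqrt k * m) := by
        gcongr
        rw [hm]
        have h1 : u * Real.sqrt k ≤ Real.sqrt k := mul_le_of_le_one_left (by positivity) hu1
        have h2 : 0 ≤ (Real.sqrt k - 1) * (51 / 50 * τ + 1 / 25) :=
          mul_nonneg (by linarith) (by linarith)
        linarith
  -- Squaring √k produces a factor k, absorbed by ρkQ = D; then αD ≤ ‖g‖ brings the term to the unit
  -- ρ‖g‖ of the first-order term.
  have hsecond : α * Q / 2 * ‖w - y‖ ^ 2 ≤ ρ * ‖g‖ * (m ^ 2 / 2) := by
    calc α * Q / 2 * ‖w - y‖ ^ 2 ≤ α * Q / 2 * (ρ * (Real.sqrt k * m)) ^ 2 := by gcongr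
      _ = ρ * (α * (ρ * (k * Q))) * (m ^ 2 / 2) := by
        rw [mul_pow, mul_pow, Real.sq_sqrt (by positivity)]; ring
      _ = ρ * (α * D) * (m ^ 2 / 2) := by
        rw [hρ]; field_simp
      _ ≤ ρ * ‖g‖ * (m ^ 2 / 2) := by gcongr
  have hsm := hs.2 y w
  have hnum := step_numeric hτ0 hτ1
  have hprog : 1 / (10 * (k * Q)) * gap ≤ ρ * ‖g‖ * (1 / 10) := by
    calc 1 / (10 * (k * Q)) * gap ≤ 1 / (10 * (k * Q)) * (‖g‖ * D) := by gcongr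
      _ = ρ * ‖g‖ * (1 / 10) := by rw [hρ]; field_simp
  have hfin : ρ * ‖g‖ * (1 / 10) ≤ ρ * ‖g‖ * (τ - 1 / 25 - m ^ 2 / 2) := by gcongr
  have : G w ≤ G y - ρ * ‖g‖ * (τ - 1 / 25) + ρ * ‖g‖ * (m ^ 2 / 2) := by linarith
  linarith

end Deterministic

/-! ### The best candidate as a recursion. -/

section BestOf

variable {E : Type*}

/-- The first point with the least value of `f` among `x, h 0, …, h (m - 1)`. -/
noncomputable def bestOf (f : E → ℝ) (x : E) (h : ℕ → E) : ℕ → E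
  | 0 => x
  | m + 1 => if f (h m) < f (bestOf f x h m) then h m else bestOf f x h m

/-- Only a strictly smaller value replaces the current best, which is the tie-breaking of
`List.argmin`. -/
lemma argmin_cons_map_range (f : E → ℝ) (x : E) (h : ℕ → E) (m : ℕ) :
    (x :: (List.range m).map h).argmin f = some (bestOf f x h m) := by
  induction m with
  | zero => simp [bestOf]
  | succ m ih =>
    rw [List.range_succ, List.map_append, ← List.cons_append, List.map_singleton,
      List.argmin_concat, ih, bestOf]
    simp only
    split_ifs <;> rfl

lemma bestOf_le_bestOf (f : E → ℝ) (x : E) (h : ℕ → E) (m : ℕ) :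
    f (bestOf f x h (m + 1)) ≤ f (bestOf f x h m) := by
  rw [bestOf]
  split_ifs with hlt
  · exact hlt.le
  · exact le_rfl

lemma bestOf_le_start (f : E → ℝ) (x : E) (h : ℕ → E) (m : ℕ) : f (bestOf f x h m) ≤ f x :=
  antitone_nat_of_succ_le (f := fun m => f (bestOf f x h m)) (bestOf_le_bestOf f x h)
    (Nat.zero_le m)

lemma bestOf_le (f : E → ℝ) (x : E) (h : ℕ → E) {m i : ℕ} (hi : i < m) :
    f (bestOf f x h m) ≤ f (h i) := by
  refine (antitone_nat_of_succ_le (f := fun m => f (bestOf f x h m)) (bestOf_le_bestOf f x h)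
    (Nat.succ_le_of_lt hi)).trans ?_
  simp only [Nat.succ_eq_add_one]
  rw [bestOf]
  split_ifs with hlt
  · exact le_rfl
  · exact not_lt.1 hlt

lemma bestOf_congr {f f' : E → ℝ} (hf : ∀ a b, f a < f b ↔ f' a < f' b) (x : E) (h : ℕ → E)
    (m : ℕ) : bestOf f x h m = bestOf f' x h m := by
  induction m with
  | zero => rfl
  | succ m ih =>
    rw [bestOf, bestOf, ih]
    simp only [hf]

lemma measurable_bestOf {α : Type*} [MeasurableSpace α] [MeasurableSpace E] {f : E → ℝ}
    (hf : Measurable f) {x : α → E} (hx : Measurable x) {h : ℕ → α → E}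
    (hh : ∀ i, Measurable (h i)) (m : ℕ) :
    Measurable fun a => bestOf f (x a) (fun i => h i a) m := by
  induction m with
  | zero => exact hx
  | succ m ih =>
    exact Measurable.ite (measurableSet_lt (hf.comp (hh m)) (hf.comp ih)) (hh m) ih

end BestOf

/-! ### One iteration, monotonicity of the values, and the radius schedule. -/

section Step

variable {n : ℕ}

/-- One iteration of GLD-Fast. -/
noncomputable def gldStep (f : Eu n → ℝ) (K : ℕ) (R : ℝ) (v : ℤ → Eu n) (x : Eu n) : Eu n :=
  ((gldCandidates K R v x).argmin f).getD x

lemma gldCandidates_eq (K : ℕ) (R : ℝ) (v : ℤ → Eu n) (x : Eu n) :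
    gldCandidates K R v x = x :: (List.range (2 * K + 1)).map fun i : ℕ =>
      x + ((2 : ℝ) ^ (-((i : ℤ) - (K : ℤ))) * R) • v ((i : ℤ) - (K : ℤ)) := by
  simp [gldCandidates, ← List.map_eq_flatMap]

lemma gldStep_eq_bestOf (f : Eu n → ℝ) (K : ℕ) (R : ℝ) (v : ℤ → Eu n) (x : Eu n) :
    gldStep f K R v x = bestOf f x (fun i =>
      x + ((2 : ℝ) ^ (-((i : ℤ) - (K : ℤ))) * R) • v ((i : ℤ) - (K : ℤ))) (2 * K + 1) := by
  rw [gldStep, gldCandidates_eq, argmin_cons_map_range]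
  rfl

lemma gldStep_le_start (f : Eu n → ℝ) (K : ℕ) (R : ℝ) (v : ℤ → Eu n) (x : Eu n) :
    f (gldStep f K R v x) ≤ f x := by
  rw [gldStep_eq_bestOf]
  exact bestOf_le_start _ _ _ _

lemma gldStep_le (f : Eu n → ℝ) {K : ℕ} (R : ℝ) (v : ℤ → Eu n) (x : Eu n) {j : ℤ}
    (hj : |j| ≤ K) : f (gldStep f K R v x) ≤ f (x + ((2 : ℝ) ^ (-j) * R) • v j) := by
  rw [gldStep_eq_bestOf]
  rw [abs_le] at hj
  have h := bestOf_le f x (fun i : ℕ =>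
      x + ((2 : ℝ) ^ (-((i : ℤ) - (K : ℤ))) * R) • v ((i : ℤ) - (K : ℤ)))
    (m := 2 * K + 1) (i := (j + K).toNat) (by omega)
  have e : (((j + K).toNat : ℤ) - (K : ℤ)) = j := by omega
  simpa only [e] using h

lemma measurable_gldStep {f : Eu n → ℝ} (hf : Measurable f) (K : ℕ) (R : ℝ) :
    Measurable fun p : Eu n × (ℤ → Eu n) => gldStep f K R p.2 p.1 := by
  simp only [gldStep_eq_bestOf]
  exact measurable_bestOf hf measurable_fst (fun i => by fun_prop) _

lemma gldFast_succ_point (f : Eu n → ℝ) (K H : ℕ) (R₀ : ℝ) (x₀ : Eu n) (v : ℕ → ℤ → Eu n)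
    (t : ℕ) : (gldFast f K H R₀ x₀ v (t + 1)).point =
      gldStep f K (gldRadius R₀ H (t + 1)) (v (t + 1)) (gldFast f K H R₀ x₀ v t).point := rfl

lemma gldFast_evals (f : Eu n → ℝ) (K H : ℕ) (R₀ : ℝ) (x₀ : Eu n) (v : ℕ → ℤ → Eu n)
    (t : ℕ) : (gldFast f K H R₀ x₀ v t).evals = t * (2 * K + 2) := by
  induction t with
  | zero => simp [gldFast]
  | succ t ih =>
    simp only [gldFast, ih, gldCandidates_eq, List.length_cons, List.length_map, List.length_range]
    ring

lemma gldFast_antitone (f : Eu n → ℝ) (K H : ℕ) (R₀ : ℝ) (x₀ : Eu n) (v : ℕ → ℤ → Eu n) :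
    Antitone fun t => f (gldFast f K H R₀ x₀ v t).point :=
  antitone_nat_of_succ_le fun t => by
    rw [gldFast_succ_point]; exact gldStep_le_start _ _ _ _ _

/-- GLD-Fast depends on the objective only through the order of its values. -/
lemma gldFast_congr {f f' : Eu n → ℝ} (hf : ∀ a b, f a < f b ↔ f' a < f' b) (K H : ℕ) (R₀ : ℝ)
    (x₀ : Eu n) (v : ℕ → ℤ → Eu n) (t : ℕ) :
    (gldFast f K H R₀ x₀ v t).point = (gldFast f' K H R₀ x₀ v t).point := by
  induction t with
  | zero => rfl
  | succ t ih =>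
    rw [gldFast_succ_point, gldFast_succ_point, ih, gldStep_eq_bestOf, gldStep_eq_bestOf,
      bestOf_congr hf]

/-- Iteration (e + 1)H, the last of its epoch, already uses the halved radius; hence an interval
instead of a single value. -/
lemma gldRadius_mem_Icc {R₀ : ℝ} (hR₀ : 0 ≤ R₀) {H e t : ℕ} (hH : 0 < H) (h0 : e * H ≤ t)
    (h1 : t ≤ (e + 1) * H) : gldRadius R₀ H t ∈ Icc (R₀ / 2 ^ e / 2) (R₀ / 2 ^ e) := by
  have h2 : e ≤ t / H := (Nat.le_div_iff_mul_le hH).2 h0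
  have h3 : t / H ≤ e + 1 := Nat.div_le_of_le_mul (by rw [mul_comm]; exact h1)
  constructor
  · rw [gldRadius, div_div, ← pow_succ]
    gcongr
    norm_num
  · rw [gldRadius]
    gcongr
    norm_num

end Step

/-! ### Measurability and independence of fresh samples from the past. -/

section Sampling

variable {n : ℕ} {Ω : Type u}

/-- The σ-algebra generated by the samples of the iterations up to `t`. -/
@[reducible] def samplePast (w : ℕ → ℤ → Ω → Eu n) (t : ℕ) : MeasurableSpace Ω :=
  ⨆ p ∈ {p : ℕ × ℤ | p.1 ≤ t}, MeasurableSpace.comap (w p.1 p.2) inferInstance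

lemma samplePast_mono (w : ℕ → ℤ → Ω → Eu n) : Monotone (samplePast w) := fun _ _ h =>
  biSup_mono fun _ hp => le_trans (α := ℕ) hp h

lemma measurable_sample_past (w : ℕ → ℤ → Ω → Eu n) {t s : ℕ} (h : s ≤ t) (k : ℤ) :
    Measurable[samplePast w t] (w s k) := by
  rw [measurable_iff_comap_le]
  exact le_biSup (fun p : ℕ × ℤ => MeasurableSpace.comap (w p.1 p.2) inferInstance)
    (i := (s, k)) h

lemma measurable_gldFast_point {f : Eu n → ℝ} (hf : Measurable f) (K H : ℕ) (R₀ : ℝ)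
    (x₀ : Eu n) (w : ℕ → ℤ → Ω → Eu n) (t : ℕ) :
    Measurable[samplePast w t]
      fun ω => (gldFast f K H R₀ x₀ (fun t k => w t k ω) t).point := by
  induction t with
  | zero => exact measurable_const
  | succ t ih =>
    have h1 := ih.mono (samplePast_mono w t.le_succ) le_rfl
    have h2 : Measurable[samplePast w (t + 1)] fun ω k => w (t + 1) k ω :=
      @measurable_pi_lambda _ _ _ (_) _ _ fun k => measurable_sample_past w le_rfl k
    exact (measurable_gldStep hf K (gldRadius R₀ H (t + 1))).comp (h1.prodMk h2)

variable [MeasurableSpace Ω] {μ : Measure Ω} {σ : ℝ} {w : ℕ → ℤ → Ω → Eu n}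

lemma IsGaussianSampling.samplePast_le (hw : IsGaussianSampling μ σ w) (t : ℕ) :
    samplePast w t ≤ ‹MeasurableSpace Ω› :=
  iSup₂_le fun p _ => (hw.measurable p.1 p.2).comap_le

/-- What depends on the samples up to iteration `t` is independent of those of iteration `t + 1`. -/
lemma IsGaussianSampling.indepFun_succ (hw : IsGaussianSampling μ σ w) {S : Type*}
    [MeasurableSpace S] {t : ℕ} {X : Ω → S} (hX : Measurable[samplePast w t] X) :
    IndepFun X (fun ω k => w (t + 1) k ω) μ := by
  have hd : Disjoint {p : ℕ × ℤ | p.1 ≤ t} {p : ℕ × ℤ | p.1 = t + 1} := by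
    rw [Set.disjoint_left]
    intro p hp hp'
    simp only [mem_ofPred_eq] at hp hp'
    omega
  have h := indep_iSup_of_disjoint
    (m := fun p : ℕ × ℤ => MeasurableSpace.comap (w p.1 p.2) inferInstance)
    (fun p => (hw.measurable p.1 p.2).comap_le) hw.indep hd
  rw [IndepFun_iff_Indep]
  refine indep_of_indep_of_le h ?_ ?_
  · exact measurable_iff_comap_le.1 hX
  · rw [← measurable_iff_comap_le]
    refine @measurable_pi_lambda _ _ _ (_) _ _ fun k => ?_
    rw [measurable_iff_comap_le]
    exact le_biSup (fun p : ℕ × ℤ => MeasurableSpace.comap (w p.1 p.2) inferInstance)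
      (i := (t + 1, k)) rfl

/-- A one-step estimate for a random variable and an independent sample. -/
lemma IndepFun.lintegral_le {S T : Type*} [MeasurableSpace S] [MeasurableSpace T]
    [IsProbabilityMeasure μ] {X : Ω → S} {U : Ω → T} (hX : Measurable X) (hU : Measurable U)
    (hind : IndepFun X U μ) {ψ : S × T → ENNReal} (hψ : Measurable ψ) {φ : S → ENNReal}
    (hφ : Measurable φ) {ρ : ENNReal} (h : ∀ x, ∫⁻ ω, ψ (x, U ω) ∂μ ≤ ρ * φ x) :
    ∫⁻ ω, ψ (X ω, U ω) ∂μ ≤ ρ * ∫⁻ ω, φ (X ω) ∂μ := by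
  have := Measure.isProbabilityMeasure_map (μ := μ) hU.aemeasurable
  have := Measure.isProbabilityMeasure_map (μ := μ) hX.aemeasurable
  have e := (indepFun_iff_map_prod_eq_prod_map_map hX.aemeasurable hU.aemeasurable).1 hind
  calc ∫⁻ ω, ψ (X ω, U ω) ∂μ = ∫⁻ p, ψ p ∂(μ.map fun ω => (X ω, U ω)) :=
        (lintegral_map hψ (hX.prodMk hU)).symm
    _ = ∫⁻ x, ∫⁻ u, ψ (x, u) ∂(μ.map U) ∂(μ.map X) := by
        rw [e, lintegral_prod _ hψ.aemeasurable]
    _ ≤ ∫⁻ x, ρ * φ x ∂(μ.map X) := by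
        refine lintegral_mono fun x => ?_
        rw [lintegral_map (by fun_prop) hU]
        exact h x
    _ = ρ * ∫⁻ ω, φ (X ω) ∂μ := by
        rw [lintegral_const_mul _ hφ, lintegral_map hφ hX]

end Sampling

/-! ### The noisy model, its potential, and the drop at a good sample. -/

section Core

/-- The coordinates `Aᵀ x` of `x` in the column space of `A`. -/
noncomputable def coordA {n k : ℕ} (A : Eu k →ₗᵢ[ℝ] Eu n) : Eu n →L[ℝ] Eu k :=
  ContinuousLinearMap.adjoint A.toContinuousLinearMap

/-- `f` is, up to an error `δ`, the function `G` of the coordinates `Aᵀ x`, where `G` is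
order-equivalent to the `α`-strongly convex and `α Q`-smooth function `Gt` and is convex along the
rays from its minimizer `ystar`. -/
structure IsNoisyConvex {n k : ℕ} (A : Eu k →ₗᵢ[ℝ] Eu n) (f : Eu n → ℝ) (G Gt : Eu k → ℝ)
    (ystar : Eu k) (α Q δ : ℝ) : Prop where
  one_le : 1 ≤ k
  le_dim : k ≤ n
  two_le : 2 ≤ Q
  alpha_pos : 0 < α
  noise_nonneg : 0 ≤ δ
  measurable : Measurable f
  convex : IsStronglyConvex α Gt
  smooth : IsSmooth (α * Q) Gt
  order : ∀ a b, G a ≤ G b ↔ Gt a ≤ Gt b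
  isMin : ∀ y, G ystar ≤ G y
  ray : ∀ y (t : ℝ), 0 ≤ t → t ≤ 1 → G (ystar + t • (y - ystar)) - G ystar ≤ t * (G y - G ystar)
  approx : ∀ x, |f x - G (coordA A x)| ≤ δ

/-- The gap of `G` below which the noise may hide all progress. -/
noncomputable def noiseFloor (k : ℕ) (Q δ : ℝ) : ℝ := 2 * δ * (25 * (k * Q) + 1)

/-- The largest gap of `Gt` at a point that may have an objective value of at most `l`. -/
noncomputable def levelGap {k : ℕ} (G Gt : Eu k → ℝ) (ystar : Eu k) (δ l : ℝ) : ENNReal :=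
  ⨆ y, ⨆ _ : G y ≤ l + δ, ENNReal.ofReal (Gt y - Gt ystar)

/-- The value `l` is above the noise, and above the values at all points with gap at most `a`. -/
def IsActive {n k : ℕ} (A : Eu k →ₗᵢ[ℝ] Eu n) (f : Eu n → ℝ) (G Gt : Eu k → ℝ)
    (ystar : Eu k) (Q δ a l : ℝ) : Prop :=
  (∀ x, Gt (coordA A x) - Gt ystar ≤ a → f x < l) ∧
    ∃ y, G ystar + noiseFloor k Q δ < G y ∧ G y ≤ l + δ

/-- The value `l` is at most that of some point with gap at most `b`. -/
def IsReached {n k : ℕ} (A : Eu k →ₗᵢ[ℝ] Eu n) (f : Eu n → ℝ) (Gt : Eu k → ℝ)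
    (ystar : Eu k) (b l : ℝ) : Prop :=
  ∃ x, l ≤ f x ∧ Gt (coordA A x) - Gt ystar ≤ b

open Classical in
/-- The potential that decreases in expectation. -/
noncomputable def potential {n k : ℕ} (A : Eu k →ₗᵢ[ℝ] Eu n) (f : Eu n → ℝ) (G Gt : Eu k → ℝ)
    (ystar : Eu k) (Q δ a l : ℝ) : ENNReal :=
  if IsActive A f G Gt ystar Q δ a l then levelGap G Gt ystar δ l ^ (10 * (k * Q)) else 0

variable {n k : ℕ} {A : Eu k →ₗᵢ[ℝ] Eu n} {f : Eu n → ℝ} {G Gt : Eu k → ℝ} {ystar : Eu k}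
  {α Q δ : ℝ}

lemma levelGap_mono : Monotone (levelGap G Gt ystar δ) := fun _ _ h =>
  iSup_mono fun _ => iSup_mono' fun hy => ⟨hy.trans (by linarith), le_rfl⟩

lemma gap_le_levelGap {y : Eu k} {l : ℝ} (h : G y ≤ l + δ) :
    ENNReal.ofReal (Gt y - Gt ystar) ≤ levelGap G Gt ystar δ l :=
  le_iSup₂ (f := fun y (_ : G y ≤ l + δ) => ENNReal.ofReal (Gt y - Gt ystar)) y h

lemma IsActive.mono {a l l' : ℝ} (h : IsActive A f G Gt ystar Q δ a l) (hl : l ≤ l') :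
    IsActive A f G Gt ystar Q δ a l' := by
  obtain ⟨h1, y, h2, h3⟩ := h
  exact ⟨fun x hx => (h1 x hx).trans_le hl, y, h2, h3.trans (by linarith)⟩

lemma IsReached.anti {b l l' : ℝ} (h : IsReached A f Gt ystar b l) (hl : l' ≤ l) :
    IsReached A f Gt ystar b l' := by
  obtain ⟨x, h1, h2⟩ := h
  exact ⟨x, hl.trans h1, h2⟩

namespace IsNoisyConvex

variable (S : IsNoisyConvex A f G Gt ystar α Q δ)

include S

lemma two_le_mul : 2 ≤ k * Q := by
  have h1 : (1 : ℝ) ≤ k := by exact_mod_cast S.one_le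
  have h2 := S.two_le
  nlinarith only [h1, h2]

lemma isMin_gt (y : Eu k) : Gt ystar ≤ Gt y := (S.order _ _).1 (S.isMin y)

lemma le_add (x : Eu n) : f x ≤ G (coordA A x) + δ := by
  have := (abs_le.1 (S.approx x)).2
  linarith

lemma value_le_add (x : Eu n) : G (coordA A x) ≤ f x + δ := by
  have := (abs_le.1 (S.approx x)).1
  linarith

/-- A higher level stays active and has a larger sublevel set. Monotonicity serves twice: the
potential cannot rise along a run, and it is measurable without any study of the supremum. -/
lemma potential_mono (a : ℝ) : Monotone (potential A f G Gt ystar Q δ a) := by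
  intro l l' h
  unfold potential
  by_cases hB : IsActive A f G Gt ystar Q δ a l
  · rw [if_pos hB, if_pos (hB.mono h)]
    have := S.two_le_mul
    exact ENNReal.rpow_le_rpow (levelGap_mono h) (by linarith)
  · rw [if_neg hB]
    exact zero_le

/-- Points above the threshold are not too close to the minimizer. -/
lemma lt_dist_sq {R : ℝ} {x : Eu n}
    (hB : IsActive A f G Gt ystar Q δ (α * R ^ 2 / 8) (f x)) :
    R ^ 2 < 4 * Q * ‖coordA A x - ystar‖ ^ 2 := by
  have h1 : α * R ^ 2 / 8 < Gt (coordA A x) - Gt ystar := by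
    by_contra! h
    exact lt_irrefl _ (hB.1 x h)
  have h2 := S.smooth.sub_min_le S.isMin_gt (coordA A x)
  have h3 : α * R ^ 2 < α * (4 * Q * ‖coordA A x - ystar‖ ^ 2) := by linarith
  exact lt_of_mul_lt_mul_left h3 S.alpha_pos.le

/-- Points of a reached level are not too far from the minimizer. -/
lemma dist_sq_le {R a l : ℝ} (hB : IsActive A f G Gt ystar Q δ a l)
    (hV : IsReached A f Gt ystar (α * Q / 2 * R ^ 2) l) {y : Eu k} (hy : G y ≤ l + δ) :
    ‖y - ystar‖ ^ 2 ≤ 4 * Q * R ^ 2 := by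
  obtain ⟨-, y2, hy2, hy2'⟩ := hB
  obtain ⟨xh, hxh, hgap⟩ := hV
  set yh := coordA A xh
  have h1 := S.le_add xh
  have hkQ := S.two_le_mul
  have hδ := S.noise_nonneg
  have hfl : 4 * δ ≤ noiseFloor k Q δ := by
    have : 0 ≤ δ * (k * Q - 2) := mul_nonneg hδ (by linarith)
    rw [noiseFloor]; linarith
  -- G y exceeds G yh by at most 2δ, and the witness above the noise floor forces G yh > G ystar +
  -- 2δ; so the midpoint of y and ystar is no worse than yh. Halving the distance accounts for the 4
  -- in 4Q.
  have hray := S.ray y (1 / 2) (by norm_num) (by norm_num)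
  have hmid : G (ystar + (1 / 2 : ℝ) • (y - ystar)) ≤ G yh := by linarith
  have hmid' := (S.order _ _).1 hmid
  have h2 := S.convex.le_sub_min S.isMin_gt (ystar + (1 / 2 : ℝ) • (y - ystar))
  rw [add_sub_cancel_left, norm_smul, mul_pow, Real.norm_of_nonneg (by norm_num)] at h2
  have h3 : α * ‖y - ystar‖ ^ 2 ≤ α * (4 * Q * R ^ 2) := by linarith
  exact le_of_mul_le_mul_left h3 S.alpha_pos

lemma levelGap_le {R a l : ℝ} (hB : IsActive A f G Gt ystar Q δ a l)
    (hV : IsReached A f Gt ystar (α * Q / 2 * R ^ 2) l) :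
    levelGap G Gt ystar δ l ≤ ENNReal.ofReal (2 * α * Q ^ 2 * R ^ 2) := by
  refine iSup₂_le fun y hy => ENNReal.ofReal_le_ofReal ?_
  have h1 := S.smooth.sub_min_le S.isMin_gt y
  have h2 := S.dist_sq_le hB hV hy
  have : 0 ≤ α * Q := mul_nonneg S.alpha_pos.le (by linarith [S.two_le])
  calc _ ≤ α * Q / 2 * ‖y - ystar‖ ^ 2 := h1
    _ ≤ α * Q / 2 * (4 * Q * R ^ 2) := by gcongr
    _ = _ := by ring

/-- If a stretched point has a small gap, then so have all points with a value that is, up to the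
noise, at most that of the point. -/
lemma gap_le_of_stretched {p y y2 : Eu k} {l b : ℝ} (hl : l ≤ G p + δ)
    (hq : Gt (ystar + (1 + 1 / (25 * (k * Q))) • (p - ystar)) - Gt ystar ≤ b)
    (hy2 : G ystar + noiseFloor k Q δ < G y2) (hy2' : G y2 ≤ l + δ) (hy : G y ≤ l + δ) :
    Gt y - Gt ystar ≤ b := by
  have key : ∀ z, G ystar + noiseFloor k Q δ < G z → G z ≤ l + δ → Gt z - Gt ystar ≤ b := by
    intro z hz hz'
    by_contra! hlt
    have hkQ := S.two_le_mul
    set θ : ℝ := 1 / (25 * (k * Q)) with hθ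
    have hθ0 : 0 < θ := by positivity
    set q := ystar + (1 + θ) • (p - ystar) with hqdef
    -- A larger gap at z would give G q ≤ G z ≤ G p + 2δ. Since stretching raises the gap of G at p
    -- by at least the factor 1 + θ, this leaves θ(G p - G ystar) ≤ 2δ, which puts z under the noise
    -- floor.
    have hqz : G q ≤ G z := (S.order _ _).2 (by linarith)
    have hray := S.ray q (1 + θ)⁻¹ (by positivity) (inv_le_one_of_one_le₀ (by linarith))
    have hp : ystar + (1 + θ)⁻¹ • (q - ystar) = p := by
      rw [hqdef, add_sub_cancel_left, smul_smul, inv_mul_cancel₀ (by positivity), one_smul]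
      abel
    rw [hp] at hray
    have h1 : (1 + θ) * (G p - G ystar) ≤ G q - G ystar := by
      have := mul_le_mul_of_nonneg_left hray (by positivity : 0 ≤ 1 + θ)
      rwa [← mul_assoc, mul_inv_cancel₀ (by positivity), one_mul] at this
    have h2 : θ * (G p - G ystar) ≤ 2 * δ := by linarith
    have h3 : G p - G ystar ≤ 25 * (k * Q) * (2 * δ) := by
      calc G p - G ystar = 25 * (k * Q) * (θ * (G p - G ystar)) := by
            rw [← mul_assoc, hθ, mul_one_div_cancel (by positivity), one_mul]
        _ ≤ _ := by gcongr
    rw [noiseFloor] at hz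
    linarith
  by_cases hy3 : G ystar + noiseFloor k Q δ < G y
  · exact key y hy3 hy
  -- A point within the noise is dominated by the witness y2, to which the main case applies;
  -- activity demands a witness for this purpose.
  · have := (S.order y y2).1 (by linarith)
    linarith [key y2 hy2 hy2']

/-- The sweep contains a radius of the right order of magnitude. -/
lemma exists_scale {R R' D : ℝ} {K : ℕ} (hR : 0 < R) (hR'0 : R / 2 ≤ R') (hR'1 : R' ≤ R)
    (hK : 4 * Real.sqrt Q * (n / k) ≤ 2 ^ K) (hD : 0 < D) (h0 : R ^ 2 < 4 * Q * D ^ 2)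
    (h1 : D ^ 2 ≤ 4 * Q * R ^ 2) :
    ∃ j : ℤ, |j| ≤ K ∧ D / 2 ≤ (2 : ℝ) ^ (-j) * R' * (k / n) ∧
      (2 : ℝ) ^ (-j) * R' * (k / n) ≤ D := by
  have hk : (0 : ℝ) < k := by exact_mod_cast S.one_le
  have hn : (k : ℝ) ≤ n := by exact_mod_cast S.le_dim
  have hR' : 0 < R' := by linarith
  set N : ℝ := n / k with hN
  have hN1 : 1 ≤ N := by rw [hN, one_le_div hk]; exact hn
  have hkn : (k : ℝ) / n = N⁻¹ := by rw [hN, inv_div]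
  have hQ := S.two_le
  have hs : 0 < Real.sqrt Q := Real.sqrt_pos.2 (by linarith)
  have hsq : Real.sqrt Q ^ 2 = Q := Real.sq_sqrt (by linarith)
  have h0' : R < 2 * Real.sqrt Q * D := by
    apply lt_of_pow_lt_pow_left₀ 2 (by positivity)
    rw [mul_pow, mul_pow, hsq]; linarith
  have h1' : D ≤ 2 * Real.sqrt Q * R := by
    apply le_of_sq_le_sq _ (by positivity)
    rw [mul_pow, mul_pow, hsq]; linarith
  -- Rounding Dn/(kR') down to a power of 2 loses less than a factor 2; the index sought is -i.
  obtain ⟨i, hi0, hi1⟩ := exists_mem_Ico_zpow (x := D * N / R') (y := 2) (by positivity)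
    (by norm_num)
  rw [le_div_iff₀ hR'] at hi0
  rw [div_lt_iff₀ hR'] at hi1
  -- D ≤ 2√Q·R and R ≤ 2R' produce the 4√Q of the sweep; at the other end the second factor 2 pays
  -- for the rounding.
  have hup : (2 : ℝ) ^ i ≤ 2 ^ (K : ℤ) := by
    rw [zpow_natCast]
    refine le_trans ?_ hK
    refine le_of_mul_le_mul_right (hi0.trans ?_) hR'
    calc D * N ≤ (2 * Real.sqrt Q * R) * N := by gcongr
      _ ≤ (2 * Real.sqrt Q * (2 * R')) * N := by gcongr; linarith
      _ = _ := by ring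
  have hlo : (2 : ℝ) ^ (-(K : ℤ)) < 2 ^ i := by
    have e1 : (2 : ℝ) ^ (i + 1) = 2 ^ i * 2 := by rw [zpow_add₀ (by norm_num), zpow_one]
    rw [e1] at hi1
    rw [zpow_neg, zpow_natCast, inv_lt_iff_one_lt_mul₀ (by positivity)]
    have h2 : R' < 2 * Real.sqrt Q * (2 ^ i * 2 * R') := by
      calc R' < 2 * Real.sqrt Q * D := by linarith
        _ ≤ 2 * Real.sqrt Q * (D * N) := by
          gcongr; exact le_mul_of_one_le_right hD.le hN1
        _ ≤ _ := by gcongr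
    have h3 : 1 < 4 * Real.sqrt Q * 2 ^ i := by
      refine lt_of_mul_lt_mul_right ?_ hR'.le
      linarith
    have h4 : 4 * Real.sqrt Q ≤ 2 ^ K :=
      (le_mul_of_one_le_right (by positivity) hN1).trans hK
    calc (1 : ℝ) < 4 * Real.sqrt Q * 2 ^ i := h3
      _ ≤ 2 ^ K * 2 ^ i := by gcongr
      _ = 2 ^ i * 2 ^ K := mul_comm _ _
  refine ⟨-i, ?_, ?_, ?_⟩
  · rw [abs_neg, abs_le]
    exact ⟨((zpow_lt_zpow_iff_right₀ (by norm_num)).1 hlo).le,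
      (zpow_le_zpow_iff_right₀ (by norm_num)).1 hup⟩
  · rw [neg_neg, hkn, ← div_eq_mul_inv, le_div_iff₀ (by linarith)]
    rw [zpow_add₀ (by norm_num), zpow_one] at hi1
    linarith
  · rw [neg_neg, hkn, ← div_eq_mul_inv, div_le_iff₀ (by linarith)]
    exact hi0

/-- From an active point some radius of the sweep makes the potential drop whenever the sample is
good. -/
lemma exists_potential_le {R R' : ℝ} {K : ℕ} (hR : 0 < R) (hR'0 : R / 2 ≤ R') (hR'1 : R' ≤ R)
    (hK : 4 * Real.sqrt Q * (n / k) ≤ 2 ^ K) {x : Eu n}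
    (hB : IsActive A f G Gt ystar Q δ (α * R ^ 2 / 8) (f x))
    (hV : IsReached A f Gt ystar (α * Q / 2 * R ^ 2) (f x)) :
    ∃ (j : ℤ) (e : Eu k), ‖e‖ = 1 ∧ ∀ (v : ℤ → Eu n), ∀ z ∈ goodSamples e,
      coordA A (v j) = (1 / 20 / (n * Q) : ℝ) • z →
      potential A f G Gt ystar Q δ (α * R ^ 2 / 8) (f (gldStep f K R' v x)) ≤
        ENNReal.ofReal (Real.exp (-1)) *
          potential A f G Gt ystar Q δ (α * R ^ 2 / 8) (f x) := by
  set y := coordA A x with hy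
  have hQ := S.two_le
  have hk : (0 : ℝ) < k := by exact_mod_cast S.one_le
  have hn : (0 : ℝ) < n := by exact_mod_cast S.one_le.trans S.le_dim
  have hlow := S.lt_dist_sq hB
  have hD : 0 < ‖y - ystar‖ := by
    rw [norm_pos_iff]
    intro h
    rw [← hy, h] at hlow
    simp only [norm_zero] at hlow
    nlinarith only [hlow, sq_nonneg R]
  have hne : y ≠ ystar := fun h => by simp [h] at hD
  obtain ⟨j, hj, hr0, hr1⟩ := S.exists_scale hR hR'0 hR'1 hK hD hlow
    (S.dist_sq_le hB hV (S.value_le_add x))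
  have hg : gradient Gt y ≠ 0 := by
    intro hg
    have h1 := S.convex.2 y ystar
    rw [hg, inner_zero_left, norm_sub_rev] at h1
    have h2 := S.isMin_gt y
    have : 0 < α / 2 * ‖y - ystar‖ ^ 2 := by have := S.alpha_pos; positivity
    linarith
  refine ⟨j, -(‖gradient Gt y‖⁻¹ • gradient Gt y), ?_, fun v z hz hv => ?_⟩
  · rw [norm_neg, norm_smul, norm_inv, norm_norm, inv_mul_cancel₀ (norm_ne_zero_iff.2 hg)]
  have hstep := stretched_step_le S.alpha_pos hQ S.one_le S.convex S.smooth S.isMin_gt hne hz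
    hr0 hr1
  -- The factor k/n in the scale turns the sampling width 1/(nQ) into the 1/(kQ) needed in k
  -- coordinates, so the sampling law need not depend on k.
  set p := y + ((2 : ℝ) ^ (-j) * R' * (k / n) * (1 / 20) / (k * Q)) • z with hp
  have hcp : coordA A (x + ((2 : ℝ) ^ (-j) * R') • v j) = p := by
    rw [map_add, map_smul, hv, smul_smul, hp, ← hy]
    congr 2
    field_simp
  have hle : f (gldStep f K R' v x) ≤ G p + δ := by
    refine (gldStep_le f R' v x hj).trans ?_
    rw [← hcp]
    exact S.le_add _
  by_cases hB' : IsActive A f G Gt ystar Q δ (α * R ^ 2 / 8) (f (gldStep f K R' v x))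
  swap
  · rw [potential, if_neg hB']; exact zero_le
  rw [potential, potential, if_pos hB', if_pos hB]
  have hkQ := S.two_le_mul
  have hη : 0 ≤ 1 - 1 / (10 * (k * Q)) := by
    rw [sub_nonneg, div_le_one (by positivity)]; linarith
  obtain ⟨-, y2, hy2, hy2'⟩ := hB'
  have hW : levelGap G Gt ystar δ (f (gldStep f K R' v x)) ≤
      ENNReal.ofReal (1 - 1 / (10 * (k * Q))) * levelGap G Gt ystar δ (f x) := by
    refine iSup₂_le fun y' hy' => ?_
    calc ENNReal.ofReal (Gt y' - Gt ystar)
        ≤ ENNReal.ofReal ((1 - 1 / (10 * (k * Q))) * (Gt y - Gt ystar)) :=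
          ENNReal.ofReal_le_ofReal (S.gap_le_of_stretched hle hstep hy2 hy2' hy')
      _ = ENNReal.ofReal (1 - 1 / (10 * (k * Q))) * ENNReal.ofReal (Gt y - Gt ystar) :=
          ENNReal.ofReal_mul hη
      _ ≤ _ := by gcongr; exact gap_le_levelGap (S.value_le_add x)
  -- The exponent 10kQ is the reciprocal of the relative decrease, so the factor becomes at most
  -- e⁻¹.
  calc _ ≤ (ENNReal.ofReal (1 - 1 / (10 * (k * Q))) * levelGap G Gt ystar δ (f x)) ^
        (10 * (k * Q)) := ENNReal.rpow_le_rpow hW (by linarith)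
    _ = ENNReal.ofReal (1 - 1 / (10 * (k * Q))) ^ (10 * (k * Q)) *
        levelGap G Gt ystar δ (f x) ^ (10 * (k * Q)) := ENNReal.mul_rpow_of_nonneg _ _ (by linarith)
    _ ≤ _ := by
      gcongr
      rw [ENNReal.ofReal_rpow_of_nonneg hη (by linarith)]
      apply ENNReal.ofReal_le_ofReal
      calc (1 - 1 / (10 * (k * Q))) ^ (10 * (k * Q))
          ≤ Real.exp (-(1 / (10 * (k * Q)))) ^ (10 * (k * Q)) := by
            apply Real.rpow_le_rpow hη (Real.one_sub_le_exp_neg _) (by linarith)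
        _ = Real.exp (-1) := by
            rw [← Real.exp_mul]
            congr 1
            field_simp

end IsNoisyConvex

end Core

/-! ### Expected decrease of the potential and failure of one epoch. -/

section Probability

/-- The expected factor by which the potential drops in one iteration. -/
noncomputable def gldRate : ℝ := 1 - gaussianSuccess.toReal * (1 - Real.exp (-1))

/-- The constant in the epoch length. -/
noncomputable def epochConst : ℝ := 122 / gaussianSuccess.toReal

lemma gaussianSuccess_toReal_pos : 0 < gaussianSuccess.toReal :=
  ENNReal.toReal_pos gaussianSuccess_pos.ne' (gaussianSuccess_le_one.trans_lt (by simp)).ne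

lemma gaussianSuccess_toReal_le : gaussianSuccess.toReal ≤ 1 :=
  ENNReal.toReal_le_of_le_ofReal (by norm_num) (by simpa using gaussianSuccess_le_one)

lemma exp_neg_one_le : Real.exp (-1) ≤ 1 / 2 := by
  rw [Real.exp_neg, one_div]
  apply inv_anti₀ (by norm_num)
  linarith [Real.add_one_le_exp (1 : ℝ)]

lemma gldRate_nonneg : 0 ≤ gldRate := by
  have h1 := gaussianSuccess_toReal_le
  have h2 := gaussianSuccess_toReal_pos
  have h3 := Real.exp_pos (-1)
  rw [gldRate]
  nlinarith

lemma gldRate_le_exp : gldRate ≤ Real.exp (-(gaussianSuccess.toReal / 2)) := by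
  refine le_trans ?_ (Real.one_sub_le_exp_neg _)
  have h2 := gaussianSuccess_toReal_pos
  have h3 := exp_neg_one_le
  rw [gldRate]
  nlinarith

variable {n k : ℕ} {A : Eu k →ₗᵢ[ℝ] Eu n} {f : Eu n → ℝ} {G Gt : Eu k → ℝ} {ystar : Eu k}
  {α Q δ : ℝ} {Ω : Type u} [MeasurableSpace Ω] {μ : Measure Ω} {σ : ℝ} {w : ℕ → ℤ → Ω → Eu n}

lemma measurableSet_goodSamples_smul (A : Eu k →ₗᵢ[ℝ] Eu n) (σ : ℝ) (e : Eu k) :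
    MeasurableSet {v | σ⁻¹ • coordA A v ∈ goodSamples e} :=
  measurableSet_preimage (f := fun v => σ⁻¹ • coordA A v) (by fun_prop)
    (measurableSet_goodSamples e)

/-- The scaling cancels and Aᵀ sends the standard Gaussian of ℝⁿ to that of ℝᵏ, so the bound depends
on neither dimension. -/
lemma IsGaussianSampling.gaussianSuccess_le (hw : IsGaussianSampling μ σ w) (hσ : σ ≠ 0)
    (hk : 1 ≤ k) (A : Eu k →ₗᵢ[ℝ] Eu n) {e : Eu k} (he : ‖e‖ = 1) (t : ℕ) (j : ℤ) :
    gaussianSuccess ≤ μ {ω | σ⁻¹ • coordA A (w t j ω) ∈ goodSamples e} := by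
  have h1 : μ {ω | σ⁻¹ • coordA A (w t j ω) ∈ goodSamples e} =
      μ.map (w t j) {v | σ⁻¹ • coordA A v ∈ goodSamples e} :=
    (Measure.map_apply (hw.measurable t j) (measurableSet_goodSamples_smul A σ e)).symm
  rw [h1, hw.law, Measure.map_apply (by fun_prop) (measurableSet_goodSamples_smul A σ e)]
  have h2 : (fun z : Eu n => σ • z) ⁻¹' {v | σ⁻¹ • coordA A v ∈ goodSamples e} =
      coordA A ⁻¹' goodSamples e := by
    ext z
    simp [smul_smul, hσ]
  rw [h2, ← Measure.map_apply (by fun_prop) (measurableSet_goodSamples e)]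
  unfold coordA
  rw [stdGaussian_map_adjoint]
  exact _root_.gaussianSuccess_le hk e he

/-- The trajectory of GLD-Fast. -/
noncomputable def gldPoint (f : Eu n → ℝ) (K H : ℕ) (R₀ : ℝ) (x₀ : Eu n)
    (w : ℕ → ℤ → Ω → Eu n) (t : ℕ) (ω : Ω) : Eu n :=
  (gldFast f K H R₀ x₀ (fun t k => w t k ω) t).point

lemma measurableSet_isReached (hf : Measurable f) (b : ℝ) :
    MeasurableSet {x | IsReached A f Gt ystar b (f x)} := by
  have h : IsLowerSet {l | IsReached A f Gt ystar b l} := fun _ _ hl h => h.anti hl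
  exact hf h.ordConnected.measurableSet

namespace IsNoisyConvex

variable (S : IsNoisyConvex A f G Gt ystar α Q δ)

include S

lemma measurable_potential (a : ℝ) :
    Measurable fun x => potential A f G Gt ystar Q δ a (f x) :=
  (S.potential_mono a).measurable.comp S.measurable

/-- The start-to-goal ratio is 16Q², and log(16Q²) ≤ 6 log Q, so its power 10kQ is at most e^(60kQ
log Q). With p the success probability, the rate e^(-p/2) and the constant 122/p buy an exponent
61·r·kQ log Q: 60r cover the ratio and r is left for the failure probability. -/
lemma epoch_numeric {R r : ℝ} {H : ℕ} (hR : 0 < R) (hr : 1 ≤ r)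
    (hH : epochConst * r * k * Q * Real.log Q ≤ H) :
    gldRate ^ H * (2 * α * Q ^ 2 * R ^ 2) ^ (10 * (k * Q)) ≤
      Real.exp (-(r * k * Q * Real.log Q)) * (α * R ^ 2 / 8) ^ (10 * (k * Q)) := by
  have hkQ := S.two_le_mul
  have hα := S.alpha_pos
  have hQ := S.two_le
  have hp := gaussianSuccess_toReal_pos
  set p := gaussianSuccess.toReal
  have hlog : 0 < Real.log Q := Real.log_pos (by linarith)
  have e1 : 2 * α * Q ^ 2 * R ^ 2 = (16 * Q ^ 2) * (α * R ^ 2 / 8) := by ring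
  rw [e1, Real.mul_rpow (by positivity) (by positivity), ← mul_assoc]
  gcongr
  have h1 : gldRate ^ H ≤ Real.exp (-(p / 2) * H) := by
    calc gldRate ^ H ≤ Real.exp (-(p / 2)) ^ H :=
          pow_le_pow_left₀ gldRate_nonneg gldRate_le_exp H
      _ = _ := by rw [mul_comm, Real.exp_nat_mul]
  have h2 : Real.log (16 * Q ^ 2) ≤ 6 * Real.log Q := by
    rw [Real.log_mul (by norm_num) (by positivity), Real.log_pow]
    have : Real.log 16 = 4 * Real.log 2 := by
      rw [show (16 : ℝ) = 2 ^ 4 by norm_num, Real.log_pow]; norm_num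
    have := Real.log_le_log (by norm_num) hQ
    push_cast
    linarith
  have h3 : (16 * Q ^ 2) ^ (10 * (k * Q)) ≤ Real.exp (60 * (k * Q * Real.log Q)) := by
    rw [Real.rpow_def_of_pos (by positivity)]
    apply Real.exp_le_exp.2
    calc Real.log (16 * Q ^ 2) * (10 * (k * Q)) ≤ 6 * Real.log Q * (10 * (k * Q)) := by gcongr
      _ = _ := by ring
  have h4 : 61 * r * (k * Q * Real.log Q) ≤ p / 2 * H := by
    calc 61 * r * (k * Q * Real.log Q) = p / 2 * (epochConst * r * k * Q * Real.log Q) := by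
          rw [epochConst]
          change _ = p / 2 * (122 / p * r * k * Q * Real.log Q)
          field_simp
          ring
      _ ≤ _ := by gcongr
  have h5 : 60 * (k * Q * Real.log Q) ≤ 60 * r * (k * Q * Real.log Q) := by
    have : 0 ≤ k * Q * Real.log Q := by positivity
    nlinarith
  calc gldRate ^ H * (16 * Q ^ 2) ^ (10 * (k * Q))
      ≤ Real.exp (-(p / 2) * H) * Real.exp (60 * (k * Q * Real.log Q)) := by gcongr
    _ = Real.exp (-(p / 2) * H + 60 * (k * Q * Real.log Q)) := (Real.exp_add _ _).symm
    _ ≤ _ := Real.exp_le_exp.2 (by linarith)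

variable [IsProbabilityMeasure μ] (hw : IsGaussianSampling μ (1 / 20 / (n * Q)) w)

include hw

/-- A success, of probability at least p, contributes e⁻¹ and a failure at most 1; the average 1 -
p(1 - e⁻¹) is `gldRate`. -/
lemma lintegral_potential_step_le {R R' : ℝ} {K : ℕ} (hR : 0 < R) (hR'0 : R / 2 ≤ R')
    (hR'1 : R' ≤ R) (hK : 4 * Real.sqrt Q * (n / k) ≤ 2 ^ K) {x : Eu n}
    (hV : IsReached A f Gt ystar (α * Q / 2 * R ^ 2) (f x)) (t : ℕ) :
    ∫⁻ ω, potential A f G Gt ystar Q δ (α * R ^ 2 / 8)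
        (f (gldStep f K R' (fun k => w t k ω) x)) ∂μ ≤
      ENNReal.ofReal gldRate * potential A f G Gt ystar Q δ (α * R ^ 2 / 8) (f x) := by
  set a := α * R ^ 2 / 8
  by_cases hB : IsActive A f G Gt ystar Q δ a (f x)
  swap
  -- Values never increase, so an inactive state stays inactive.
  · have h : ∀ ω, potential A f G Gt ystar Q δ a (f (gldStep f K R' (fun k => w t k ω) x)) = 0 :=
      fun ω => if_neg fun h => hB (h.mono (gldStep_le_start f K R' (fun k => w t k ω) x))
    simp [h]
  obtain ⟨j, e, he, hgood⟩ := S.exists_potential_le hR hR'0 hR'1 hK hB hV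
  set σ : ℝ := 1 / 20 / (n * Q)
  have hQ := S.two_le
  have hn : (0 : ℝ) < n := by exact_mod_cast S.one_le.trans S.le_dim
  have hσ : σ ≠ 0 := by positivity
  set P := potential A f G Gt ystar Q δ a (f x)
  set T := {ω | σ⁻¹ • coordA A (w t j ω) ∈ goodSamples e} with hT
  have hTm : MeasurableSet T := hw.measurable t j (measurableSet_goodSamples_smul A σ e)
  have hp := hw.gaussianSuccess_le hσ S.one_le A he t j
  rw [← hT] at hp
  calc ∫⁻ ω, potential A f G Gt ystar Q δ a (f (gldStep f K R' (fun k => w t k ω) x)) ∂μ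
      ≤ ∫⁻ ω, (T.indicator (fun _ => ENNReal.ofReal (Real.exp (-1)) * P) ω +
          Tᶜ.indicator (fun _ => P) ω) ∂μ := by
        refine lintegral_mono fun ω => ?_
        by_cases hω : ω ∈ T
        · simp only [hω, indicator_of_mem, mem_compl_iff, not_true_eq_false, not_false_eq_true,
            indicator_of_notMem, add_zero]
          refine hgood _ _ hω ?_
          rw [smul_smul, mul_inv_cancel₀ hσ, one_smul]
        · simp only [hω, indicator_of_mem, mem_compl_iff, not_false_eq_true,
            indicator_of_notMem, zero_add]
          exact S.potential_mono a (gldStep_le_start _ _ _ _ _)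
    _ = (ENNReal.ofReal (Real.exp (-1)) * μ T + μ Tᶜ) * P := by
        rw [lintegral_add_left (measurable_const.indicator hTm), lintegral_indicator_const hTm,
          lintegral_indicator_const hTm.compl]
        ring
    _ ≤ ENNReal.ofReal gldRate * P := by
        gcongr
        have h1 : μ T = ENNReal.ofReal (μ.real T) := by simp
        have h2 : μ Tᶜ = ENNReal.ofReal (1 - μ.real T) := by
          rw [← probReal_compl_eq_one_sub hTm]; simp
        have h3 : μ.real T ≤ 1 := measureReal_le_one
        have h4 : gaussianSuccess.toReal ≤ μ.real T :=
          ENNReal.toReal_mono (measure_ne_top μ T) hp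
        rw [h1, h2, ← ENNReal.ofReal_mul (Real.exp_pos _).le,
          ← ENNReal.ofReal_add (mul_nonneg (Real.exp_pos _).le measureReal_nonneg) (by linarith)]
        apply ENNReal.ofReal_le_ofReal
        rw [gldRate]
        have h5 := exp_neg_one_le
        nlinarith only [h4, h5]

-- The truncation restricts to runs that start the epoch at a reached level. Since values decrease,
-- the current point is then reached too; the fresh samples are independent of both points, so the
-- one-step bound can be integrated over the past.
open Classical in
lemma lintegral_potential_epoch_le {R R₀ : ℝ} {K H : ℕ} (x₀ : Eu n) (hR : 0 < R)
    (hK : 4 * Real.sqrt Q * (n / k) ≤ 2 ^ K) (s i : ℕ)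
    (hrad : ∀ t, s ≤ t → t ≤ s + i → gldRadius R₀ H t ∈ Icc (R / 2) R) :
    ∫⁻ ω, (if IsReached A f Gt ystar (α * Q / 2 * R ^ 2) (f (gldPoint f K H R₀ x₀ w s ω)) then
        potential A f G Gt ystar Q δ (α * R ^ 2 / 8) (f (gldPoint f K H R₀ x₀ w (s + i) ω))
        else 0) ∂μ ≤
      ENNReal.ofReal gldRate ^ i * ENNReal.ofReal (2 * α * Q ^ 2 * R ^ 2) ^ (10 * (k * Q)) := by
  set a := α * R ^ 2 / 8
  set b := α * Q / 2 * R ^ 2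
  set 𝒱 := {x | IsReached A f Gt ystar b (f x)} with h𝒱
  have h𝒱m : MeasurableSet 𝒱 := measurableSet_isReached S.measurable b
  have hkQ := S.two_le_mul
  induction i with
  | zero =>
    rw [pow_zero, one_mul]
    calc _ ≤ ∫⁻ ω, ENNReal.ofReal (2 * α * Q ^ 2 * R ^ 2) ^ (10 * (k * Q)) ∂μ := by
          refine lintegral_mono fun ω => ?_
          simp only [add_zero]
          split_ifs with h
          · rw [potential]
            split_ifs with hB
            · exact ENNReal.rpow_le_rpow (S.levelGap_le hB h) (by linarith)
            · exact zero_le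
          · exact zero_le
      _ = _ := by simp
  | succ i ih =>
    have ih' := ih fun t h1 h2 => hrad t h1 (by omega)
    have hR' := hrad (s + i + 1) (by omega) (by omega)
    have hXs : Measurable[samplePast w (s + i)] (gldPoint f K H R₀ x₀ w s) :=
      (measurable_gldFast_point S.measurable K H R₀ x₀ w s).mono
        (samplePast_mono w (Nat.le_add_right s i)) le_rfl
    have hXi : Measurable[samplePast w (s + i)] (gldPoint f K H R₀ x₀ w (s + i)) :=
      measurable_gldFast_point S.measurable K H R₀ x₀ w (s + i)
    have hX := hXs.prodMk hXi
    have hU : Measurable fun ω k => w (s + i + 1) k ω :=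
      measurable_pi_lambda _ fun k => hw.measurable _ k
    have hreach : ∀ ω, gldPoint f K H R₀ x₀ w s ω ∈ 𝒱 →
        gldPoint f K H R₀ x₀ w (s + i) ω ∈ 𝒱 := fun ω h =>
      IsReached.anti h (gldFast_antitone f K H R₀ x₀ _ (Nat.le_add_right s i))
    have hm1 : Measurable fun p : (Eu n × Eu n) × (ℤ → Eu n) =>
        if p.1.1 ∈ 𝒱 ∧ p.1.2 ∈ 𝒱 then
          potential A f G Gt ystar Q δ a (f (gldStep f K (gldRadius R₀ H (s + i + 1)) p.2 p.1.2))
        else 0 := by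
      refine Measurable.ite ?_ ?_ measurable_const
      · exact ((measurable_fst.comp measurable_fst) h𝒱m).inter
          ((measurable_snd.comp measurable_fst) h𝒱m)
      · exact (S.measurable_potential a).comp
          ((measurable_gldStep S.measurable K _).comp
            ((measurable_snd.comp measurable_fst).prodMk measurable_snd))
    have hm2 : Measurable fun p : Eu n × Eu n =>
        if p.1 ∈ 𝒱 ∧ p.2 ∈ 𝒱 then potential A f G Gt ystar Q δ a (f p.2) else 0 := by
      refine Measurable.ite ((measurable_fst h𝒱m).inter (measurable_snd h𝒱m)) ?_ measurable_const
      exact (S.measurable_potential a).comp measurable_snd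
    have hstep := IndepFun.lintegral_le (hX.mono (hw.samplePast_le _) le_rfl) hU
      (hw.indepFun_succ hX) hm1 hm2 (ρ := ENNReal.ofReal gldRate) (by
        rintro ⟨x1, x2⟩
        simp only
        split_ifs with h
        · exact S.lintegral_potential_step_le hw hR hR'.1 hR'.2 hK h.2 (s + i + 1)
        · simp)
    calc _ = ∫⁻ ω, (if gldPoint f K H R₀ x₀ w s ω ∈ 𝒱 ∧ gldPoint f K H R₀ x₀ w (s + i) ω ∈ 𝒱 then
          potential A f G Gt ystar Q δ a (f (gldStep f K (gldRadius R₀ H (s + i + 1))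
            (fun k => w (s + i + 1) k ω) (gldPoint f K H R₀ x₀ w (s + i) ω))) else 0) ∂μ := by
          refine lintegral_congr fun ω => ?_
          refine if_congr ⟨fun h => ⟨h, hreach ω h⟩, fun h => h.1⟩ rfl rfl
      _ ≤ _ := hstep
      _ = ENNReal.ofReal gldRate * ∫⁻ ω, (if IsReached A f Gt ystar b
          (f (gldPoint f K H R₀ x₀ w s ω)) then potential A f G Gt ystar Q δ a
            (f (gldPoint f K H R₀ x₀ w (s + i) ω)) else 0) ∂μ := by
          congr 1
          refine lintegral_congr fun ω => ?_
          refine if_congr ⟨fun h => h.1, fun h => ⟨h, hreach ω h⟩⟩ rfl rfl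
      _ ≤ _ := by
          rw [pow_succ', mul_assoc]
          gcongr

/-- An epoch fails with exponentially small probability. -/
lemma measure_epoch_le {R R₀ r : ℝ} {K H : ℕ} (x₀ : Eu n) (hR : 0 < R) (hr : 1 ≤ r)
    (hK : 4 * Real.sqrt Q * (n / k) ≤ 2 ^ K)
    (hH : epochConst * r * k * Q * Real.log Q ≤ H) (s : ℕ)
    (hrad : ∀ t, s ≤ t → t ≤ s + H → gldRadius R₀ H t ∈ Icc (R / 2) R) :
    μ {ω | IsReached A f Gt ystar (α * Q / 2 * R ^ 2) (f (gldPoint f K H R₀ x₀ w s ω)) ∧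
        IsActive A f G Gt ystar Q δ (α * R ^ 2 / 8) (f (gldPoint f K H R₀ x₀ w (s + H) ω))} ≤
      ENNReal.ofReal (Real.exp (-(r * k * Q * Real.log Q))) := by
  classical
  have hkQ := S.two_le_mul
  have hα := S.alpha_pos
  have hQ := S.two_le
  have hI := S.lintegral_potential_epoch_le hw x₀ hR hK s H hrad
  set a := α * R ^ 2 / 8 with ha
  set b := α * Q / 2 * R ^ 2
  have ha0 : 0 < a := by positivity
  set F : Ω → ENNReal := fun ω =>
    if IsReached A f Gt ystar b (f (gldPoint f K H R₀ x₀ w s ω)) then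
      potential A f G Gt ystar Q δ a (f (gldPoint f K H R₀ x₀ w (s + H) ω)) else 0 with hF
  have hX : ∀ t, Measurable (gldPoint f K H R₀ x₀ w t) := fun t =>
    (measurable_gldFast_point S.measurable K H R₀ x₀ w t).mono (hw.samplePast_le t) le_rfl
  have hFm : Measurable F :=
    Measurable.ite ((hX s) (measurableSet_isReached S.measurable b))
      ((S.measurable_potential a).comp (hX _)) measurable_const
  -- Markov's inequality: an active end point has gap above a, hence potential at least a^(10kQ).
  have hM := mul_meas_ge_le_lintegral (μ := μ) hFm (ENNReal.ofReal a ^ (10 * (k * Q)))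
  have hsub : {ω | IsReached A f Gt ystar b (f (gldPoint f K H R₀ x₀ w s ω)) ∧
      IsActive A f G Gt ystar Q δ a (f (gldPoint f K H R₀ x₀ w (s + H) ω))} ⊆
      {ω | ENNReal.ofReal a ^ (10 * (k * Q)) ≤ F ω} := by
    rintro ω ⟨h1, h2⟩
    simp only [mem_ofPred_eq, hF]
    rw [if_pos h1, potential, if_pos h2]
    refine ENNReal.rpow_le_rpow ?_ (by linarith)
    refine le_trans (ENNReal.ofReal_le_ofReal ?_)
      (gap_le_levelGap (S.value_le_add (gldPoint f K H R₀ x₀ w (s + H) ω)))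
    by_contra! h
    exact lt_irrefl _ (h2.1 _ h.le)
  have ht0 : ENNReal.ofReal a ^ (10 * (k * Q)) ≠ 0 := by
    rw [ENNReal.ofReal_rpow_of_pos ha0]
    simp only [ne_eq, ENNReal.ofReal_eq_zero, not_le]
    positivity
  have htt : ENNReal.ofReal a ^ (10 * (k * Q)) ≠ ⊤ := by
    rw [ENNReal.ofReal_rpow_of_pos ha0]; simp
  refine (ENNReal.mul_le_mul_iff_right ht0 htt).1 ?_
  calc _ ≤ ENNReal.ofReal a ^ (10 * (k * Q)) * μ {ω | ENNReal.ofReal a ^ (10 * (k * Q)) ≤ F ω} := by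
        gcongr
    _ ≤ ENNReal.ofReal gldRate ^ H * ENNReal.ofReal (2 * α * Q ^ 2 * R ^ 2) ^ (10 * (k * Q)) :=
        hM.trans hI
    _ ≤ _ := by
        rw [ENNReal.ofReal_rpow_of_pos ha0, ENNReal.ofReal_rpow_of_pos (by positivity),
          ← ENNReal.ofReal_pow gldRate_nonneg, ← ENNReal.ofReal_mul (pow_nonneg gldRate_nonneg H),
          ← ENNReal.ofReal_mul (by positivity)]
        apply ENNReal.ofReal_le_ofReal
        rw [mul_comm (a ^ _)]
        exact S.epoch_numeric hR hr hH

end IsNoisyConvex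

end Probability

/-! ### Chaining the epochs. -/

section Epochs

variable {n k : ℕ} {A : Eu k →ₗᵢ[ℝ] Eu n} {f : Eu n → ℝ} {G Gt : Eu k → ℝ} {ystar : Eu k}
  {α Q δ : ℝ} {Ω : Type u} [MeasurableSpace Ω] {μ : Measure Ω} {w : ℕ → ℤ → Ω → Eu n}

/-- The value `l` is in the noise, or at most that of some point with gap at most `b`. -/
def IsSettled (A : Eu k →ₗᵢ[ℝ] Eu n) (f : Eu n → ℝ) (G Gt : Eu k → ℝ) (ystar : Eu k)
    (Q δ b l : ℝ) : Prop :=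
  (∀ y, G y ≤ l + δ → G y ≤ G ystar + noiseFloor k Q δ) ∨ IsReached A f Gt ystar b l

lemma isSettled_of_not_isActive {b l : ℝ} (h : ¬ IsActive A f G Gt ystar Q δ b l) :
    IsSettled A f G Gt ystar Q δ b l := by
  simp only [IsActive, not_and_or, not_forall, not_exists, not_lt] at h
  rcases h with ⟨x, hx, hl⟩ | h
  · exact Or.inr ⟨x, hl, hx⟩
  · refine Or.inl fun y hy => ?_
    by_contra! hlt
    exact (h y).elim (fun h' => absurd h' (not_le.2 hlt)) (fun h' => h' hy)

lemma coordA_apply_self (A : Eu k →ₗᵢ[ℝ] Eu n) (y : Eu k) : coordA A (A y) = y := by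
  refine ext_inner_left ℝ fun u => ?_
  rw [coordA, ContinuousLinearMap.adjoint_inner_right]
  exact A.inner_map_map u y

lemma norm_coordA_le (A : Eu k →ₗᵢ[ℝ] Eu n) (x : Eu n) : ‖coordA A x‖ ≤ ‖x‖ := by
  refine (ContinuousLinearMap.le_opNorm _ x).trans ?_
  rw [coordA, LinearIsometryEquiv.norm_map]
  exact mul_le_of_le_one_left (norm_nonneg x) A.norm_toContinuousLinearMap_le

lemma norm_projA_sub (A : Eu k →ₗᵢ[ℝ] Eu n) (x y : Eu n) :
    ‖projA A (x - y)‖ = ‖coordA A x - coordA A y‖ := by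
  rw [← map_sub]
  exact A.norm_map _

lemma prob_ge_of_compl_le [IsProbabilityMeasure μ] {s t : Set Ω} {c : ℝ} (hc : 0 ≤ c)
    (hs : μ s ≤ ENNReal.ofReal c) (h : sᶜ ⊆ t) : ENNReal.ofReal (1 - c) ≤ μ t := by
  rw [ENNReal.ofReal_sub _ hc, ENNReal.ofReal_one, tsub_le_iff_right]
  calc (1 : ENNReal) = μ univ := measure_univ.symm
    _ ≤ μ (t ∪ s) := measure_mono fun ω _ => by
        by_cases hω : ω ∈ s
        · exact Or.inr hω
        · exact Or.inl (h hω)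
    _ ≤ μ t + μ s := measure_union_le t s
    _ ≤ _ := by gcongr

namespace IsNoisyConvex

variable [IsProbabilityMeasure μ] (S : IsNoisyConvex A f G Gt ystar α Q δ)
  (hw : IsGaussianSampling μ (1 / 20 / (n * Q)) w)

include S hw

/-- One epoch halves the radius. -/
lemma measure_epoch_succ_le {R₀ r : ℝ} {K H : ℕ} {x₀ : Eu n} (hR₀ : 0 < R₀) (hr : 1 ≤ r)
    (hK : 4 * Real.sqrt Q * (n / k) ≤ 2 ^ K) (hH0 : 0 < H)
    (hH : epochConst * r * k * Q * Real.log Q ≤ H) (e : ℕ) :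
    μ {ω | ¬ IsSettled A f G Gt ystar Q δ (α / 2 * (R₀ / 2 ^ (e + 1)) ^ 2)
        (f (gldPoint f K H R₀ x₀ w ((e + 1) * H) ω))} ≤
      μ {ω | ¬ IsSettled A f G Gt ystar Q δ (α * Q / 2 * (R₀ / 2 ^ e) ^ 2)
        (f (gldPoint f K H R₀ x₀ w (e * H) ω))} +
        ENNReal.ofReal (Real.exp (-(r * k * Q * Real.log Q))) := by
  have hR : 0 < R₀ / 2 ^ e := by positivity
  have h := S.measure_epoch_le hw x₀ hR hr hK hH (e * H) (R₀ := R₀) (fun t h1 h2 => by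
    have := gldRadius_mem_Icc hR₀.le hH0 h1 (by linarith)
    exact this)
  -- The activity threshold αR²/8 is α/2 · (R/2)², a level stated in the next radius.
  have e1 : α / 2 * (R₀ / 2 ^ (e + 1)) ^ 2 = α * (R₀ / 2 ^ e) ^ 2 / 8 := by
    rw [pow_succ 2 e, ← div_div]; ring
  have e2 : (e + 1) * H = e * H + H := by ring
  rw [e1, e2]
  refine le_trans (measure_mono ?_) ((measure_union_le _ _).trans (add_le_add le_rfl h))
  intro ω hω
  by_cases hs : IsSettled A f G Gt ystar Q δ (α * Q / 2 * (R₀ / 2 ^ e) ^ 2)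
        (f (gldPoint f K H R₀ x₀ w (e * H) ω))
  · refine Or.inr ⟨?_, ?_⟩
    · rcases hs with hs | hs
      · refine absurd (Or.inl fun y hy => hs y (hy.trans ?_)) hω
        have : f (gldPoint f K H R₀ x₀ w (e * H + H) ω) ≤ f (gldPoint f K H R₀ x₀ w (e * H) ω) :=
          gldFast_antitone f K H R₀ x₀ _ (Nat.le_add_right _ _)
        linarith
      · exact hs
    · by_contra ha
      exact hω (isSettled_of_not_isActive ha)
  · exact Or.inl hs

/-- An epoch ends below α/2 times the squared new radius, while the next one only needs αQ/2 times
it; so epochs chain and their failure probabilities add. -/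
lemma measure_epochs_le {R₀ r : ℝ} {K H : ℕ} {x₀ : Eu n} (hR₀ : 0 < R₀) (hr : 1 ≤ r)
    (hK : 4 * Real.sqrt Q * (n / k) ≤ 2 ^ K) (hH0 : 0 < H)
    (hH : epochConst * r * k * Q * Real.log Q ≤ H) (hx₀ : ‖coordA A x₀ - ystar‖ ≤ R₀) (e : ℕ) :
    μ {ω | ¬ IsSettled A f G Gt ystar Q δ (α * Q / 2 * (R₀ / 2 ^ e) ^ 2)
        (f (gldPoint f K H R₀ x₀ w (e * H) ω))} ≤
      ENNReal.ofReal (e * Real.exp (-(r * k * Q * Real.log Q))) := by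
  have hα := S.alpha_pos
  have hQ := S.two_le
  induction e with
  | zero =>
    have : {ω | ¬ IsSettled A f G Gt ystar Q δ (α * Q / 2 * (R₀ / 2 ^ 0) ^ 2)
        (f (gldPoint f K H R₀ x₀ w (0 * H) ω))} = ∅ := by
      refine eq_empty_of_forall_notMem fun ω hω => hω (Or.inr ⟨x₀, ?_, ?_⟩)
      · rw [zero_mul]; exact le_rfl
      · refine (S.smooth.sub_min_le S.isMin_gt _).trans ?_
        have : 0 ≤ α * Q := by positivity
        rw [pow_zero, div_one]
        gcongr
    rw [this, measure_empty]
    exact zero_le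
  | succ e ih =>
    have h := S.measure_epoch_succ_le hw (x₀ := x₀) hR₀ hr hK hH0 hH e
    have hmono : {ω | ¬ IsSettled A f G Gt ystar Q δ (α * Q / 2 * (R₀ / 2 ^ (e + 1)) ^ 2)
        (f (gldPoint f K H R₀ x₀ w ((e + 1) * H) ω))} ⊆
        {ω | ¬ IsSettled A f G Gt ystar Q δ (α / 2 * (R₀ / 2 ^ (e + 1)) ^ 2)
        (f (gldPoint f K H R₀ x₀ w ((e + 1) * H) ω))} := by
      intro ω hω hs
      refine hω (hs.imp_right fun ⟨x, hx, hx'⟩ => ⟨x, hx, hx'.trans ?_⟩)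
      have : α ≤ α * Q := by nlinarith
      gcongr
    refine (measure_mono hmono).trans (h.trans ?_)
    calc _ ≤ ENNReal.ofReal (e * Real.exp (-(r * k * Q * Real.log Q))) +
          ENNReal.ofReal (Real.exp (-(r * k * Q * Real.log Q))) := by gcongr
      _ = _ := by
        rw [← ENNReal.ofReal_add (by positivity) (by positivity)]
        congr 1
        push_cast
        ring

/-- After `E` epochs the current point is settled with high probability. -/
lemma prob_settled {R₀ r : ℝ} {K : ℕ} {x₀ : Eu n} (hR₀ : 0 < R₀) (hr : 1 ≤ r)
    (hK : 4 * Real.sqrt Q * (n / k) ≤ 2 ^ K) (hx₀ : ‖coordA A x₀ - ystar‖ ≤ R₀) {E : ℕ}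
    (hE : 1 ≤ E) {t : Set Ω}
    (ht : ∀ ω, IsSettled A f G Gt ystar Q δ (α / 2 * (R₀ / 2 ^ E) ^ 2)
      (f (gldFast f K (gldEpoch epochConst r k Q) R₀ x₀ (fun t k => w t k ω)
        (gldEpoch epochConst r k Q * E)).point) → ω ∈ t) :
    ENNReal.ofReal (1 - E * Real.exp (-(r * k * Q * Real.log Q))) ≤ μ t := by
  set H := gldEpoch epochConst r k Q with hHdef
  have hH : epochConst * r * k * Q * Real.log Q ≤ H := Nat.le_ceil _
  have hk : (0 : ℝ) < k := by exact_mod_cast S.one_le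
  have hQ := S.two_le
  have hH0 : 0 < H := by
    have hlog : 0 < Real.log Q := Real.log_pos (by linarith)
    have hC : 0 < epochConst := div_pos (by norm_num) gaussianSuccess_toReal_pos
    have : 0 < epochConst * r * k * Q * Real.log Q := by positivity
    exact Nat.ceil_pos.2 this
  -- The last epoch is kept apart to retain the constant α/2; with αQ/2 the final distance would
  -- lose a factor √Q.
  obtain ⟨e, rfl⟩ : ∃ e, E = e + 1 := ⟨E - 1, by omega⟩
  have h1 := S.measure_epoch_succ_le hw (x₀ := x₀) hR₀ hr hK hH0 hH e
  have h2 := S.measure_epochs_le hw hR₀ hr hK hH0 hH hx₀ e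
  refine prob_ge_of_compl_le (by positivity) (h1.trans ?_) fun ω hω => ht ω ?_
  · calc _ ≤ ENNReal.ofReal (e * Real.exp (-(r * k * Q * Real.log Q))) +
          ENNReal.ofReal (Real.exp (-(r * k * Q * Real.log Q))) := by gcongr
      _ = _ := by
        rw [← ENNReal.ofReal_add (by positivity) (by positivity)]
        congr 1
        push_cast
        ring
  · rw [mem_compl_iff, mem_ofPred_eq, not_not] at hω
    rw [mul_comm H]
    exact hω

end IsNoisyConvex

end Epochs

/-! ### Logarithms, ceilings and the number of evaluations. -/

section Counting

lemma one_half_le_log {a : ℝ} (ha : 2 ≤ a) : 1 / 2 ≤ Real.log a := by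
  have h1 := Real.log_two_gt_d9
  have h2 := Real.log_le_log (by norm_num) ha
  linarith

lemma logb_two_le {a : ℝ} (ha : 1 ≤ a) : Real.logb 2 a ≤ 2 * Real.log a := by
  have h1 := one_half_le_log (le_refl (2 : ℝ))
  have h2 := Real.log_nonneg ha
  rw [Real.logb, div_le_iff₀ (by linarith)]
  nlinarith

lemma one_le_gldNumEpochs {a : ℝ} (ha : 2 ≤ a) : 1 ≤ gldNumEpochs a :=
  Nat.ceil_pos.2 (Real.logb_pos (by norm_num) (by linarith))

lemma le_two_pow_gldNumEpochs {a : ℝ} (ha : 2 ≤ a) : a ≤ 2 ^ gldNumEpochs a := by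
  have h : Real.logb 2 a ≤ gldNumEpochs a := Nat.le_ceil _
  rwa [Real.logb_le_iff_le_rpow (by norm_num) (by linarith), Real.rpow_natCast] at h

lemma gldNumEpochs_le {a : ℝ} (ha : 2 ≤ a) : (gldNumEpochs a : ℝ) ≤ 4 * Real.log a := by
  have h1 : 1 ≤ Real.logb 2 a := by
    rw [Real.le_logb_iff_rpow_le (by norm_num) (by linarith), Real.rpow_one]; exact ha
  have h2 := (Nat.ceil_lt_add_one (by linarith : 0 ≤ Real.logb 2 a)).le
  have h3 := logb_two_le (by linarith : 1 ≤ a)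
  rw [gldNumEpochs]
  linarith

lemma le_two_pow_gldSweep {Q : ℝ} (hQ : 2 ≤ Q) : 4 * Real.sqrt Q ≤ 2 ^ gldSweep Q := by
  have h : Real.logb 2 (4 * Real.sqrt Q) ≤ gldSweep Q := Nat.le_ceil _
  have : 0 < Real.sqrt Q := Real.sqrt_pos.2 (by linarith)
  rwa [Real.logb_le_iff_le_rpow (by norm_num) (by positivity), Real.rpow_natCast] at h

lemma le_two_pow_gldSweepLowRank {n : ℕ} {Q : ℝ} (hn : 1 ≤ n) (hQ : 2 ≤ Q) :
    4 * n * Real.sqrt Q ≤ 2 ^ gldSweepLowRank n Q := by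
  have h : Real.logb 2 (4 * n * Real.sqrt Q) ≤ gldSweepLowRank n Q := Nat.le_ceil _
  have : 0 < Real.sqrt Q := Real.sqrt_pos.2 (by linarith)
  have : (0 : ℝ) < n := by exact_mod_cast hn
  rwa [Real.logb_le_iff_le_rpow (by norm_num) (by positivity), Real.rpow_natCast] at h

lemma logb_four_mul_sqrt {Q b : ℝ} (hb : 1 ≤ b) (hQ : 2 ≤ Q) :
    Real.logb 2 (4 * b * Real.sqrt Q) = 2 + Real.logb 2 b + Real.logb 2 Q / 2 := by
  have hs : 0 < Real.sqrt Q := Real.sqrt_pos.2 (by linarith)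
  rw [Real.logb_mul (by positivity) hs.ne', Real.logb_mul (by norm_num) (by positivity),
    Real.sqrt_eq_rpow, Real.logb_rpow_eq_mul_logb_of_pos (by linarith)]
  have : Real.logb 2 4 = 2 := by
    rw [show (4 : ℝ) = 2 ^ (2 : ℝ) by norm_num]
    exact Real.logb_rpow (by norm_num) (by norm_num)
  rw [this]
  ring

lemma two_mul_gldSweep_add_two_le {Q : ℝ} (hQ : 2 ≤ Q) :
    2 * (gldSweep Q : ℝ) + 2 ≤ 44 * Real.log Q := by
  have e := logb_four_mul_sqrt (le_refl (1 : ℝ)) hQ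
  rw [mul_one, Real.logb_one] at e
  have h1 : 0 ≤ Real.logb 2 Q := Real.logb_nonneg (by norm_num) (by linarith)
  have h2 := (Nat.ceil_lt_add_one (by linarith : 0 ≤ Real.logb 2 (4 * Real.sqrt Q))).le
  have h3 := logb_two_le (by linarith : 1 ≤ Q)
  have h4 := one_half_le_log hQ
  rw [gldSweep]
  linarith

/-- The left side is at most 8 + 4 log n + 2 log Q, and both logarithms are at least 1/2, whence 32
+ 8 + 4 = 44. -/
lemma two_mul_gldSweepLowRank_add_two_le {n : ℕ} {Q : ℝ} (hn : 2 ≤ n) (hQ : 2 ≤ Q) :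
    2 * (gldSweepLowRank n Q : ℝ) + 2 ≤ 44 * (Real.log n * Real.log Q) := by
  have hn' : (2 : ℝ) ≤ n := by exact_mod_cast hn
  have e := logb_four_mul_sqrt (by linarith : (1 : ℝ) ≤ n) hQ
  have h0 : 0 ≤ Real.logb 2 n := Real.logb_nonneg (by norm_num) (by linarith)
  have h1 : 0 ≤ Real.logb 2 Q := Real.logb_nonneg (by norm_num) (by linarith)
  have h2 := (Nat.ceil_lt_add_one (by linarith : 0 ≤ Real.logb 2 (4 * n * Real.sqrt Q))).le
  have h3 := logb_two_le (by linarith : 1 ≤ Q)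
  have h3' := logb_two_le (by linarith : 1 ≤ (n : ℝ))
  have h4 := one_half_le_log hQ
  have h4' := one_half_le_log hn'
  rw [gldSweepLowRank]
  nlinarith

lemma one_le_epochConst : 1 ≤ epochConst := by
  rw [epochConst, one_le_div gaussianSuccess_toReal_pos]
  linarith [gaussianSuccess_toReal_le]

lemma gldEpoch_le {s Q : ℝ} {d : ℕ} (hd : 1 ≤ d) (hs : 1 ≤ s) (hQ : 2 ≤ Q) :
    (gldEpoch epochConst s d Q : ℝ) ≤ 2 * (epochConst * s * d * Q * Real.log Q) := by
  have hd' : (1 : ℝ) ≤ d := by exact_mod_cast hd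
  have hC := one_le_epochConst
  have h4 := one_half_le_log hQ
  have h1 : 1 ≤ epochConst * s * d := by
    have := one_le_mul_of_one_le_of_one_le hC hs
    exact one_le_mul_of_one_le_of_one_le this hd'
  have h2 : 1 ≤ Q * Real.log Q := by nlinarith
  have h3 : 1 ≤ epochConst * s * d * Q * Real.log Q := by
    rw [mul_assoc _ Q]
    exact one_le_mul_of_one_le_of_one_le h1 h2
  have := (Nat.ceil_lt_add_one (by linarith : 0 ≤ epochConst * s * d * Q * Real.log Q)).le
  rw [gldEpoch]
  linarith

/-- The number of evaluations. -/
lemma gldFast_evals_le {n d K : ℕ} {s Q a B : ℝ} (hd : 1 ≤ d) (hs : 1 ≤ s) (hQ : 2 ≤ Q)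
    (ha : 2 ≤ a) (hB : 2 * (K : ℝ) + 2 ≤ 44 * B) (f : Eu n → ℝ) (R₀ : ℝ) (x₀ : Eu n)
    (v : ℕ → ℤ → Eu n) :
    ((gldFast f K (gldEpoch epochConst s d Q) R₀ x₀ v
      (gldEpoch epochConst s d Q * gldNumEpochs a)).evals : ℝ) ≤
      352 * epochConst * s * (d * Q * Real.log Q * B * Real.log a) := by
  have h1 := gldEpoch_le hd hs hQ
  have h2 := gldNumEpochs_le ha
  have hC := one_le_epochConst
  have h4 := one_half_le_log hQ
  have h5 := one_half_le_log ha
  rw [gldFast_evals]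
  push_cast
  -- Epoch length, number of epochs and cost per iteration contribute 2 · 4 · 44 = 352.
  calc (gldEpoch epochConst s d Q * gldNumEpochs a * (2 * K + 2) : ℝ)
      ≤ (2 * (epochConst * s * d * Q * Real.log Q)) * (4 * Real.log a) * (44 * B) := by
        gcongr
    _ = _ := by ring

end Counting

/-! ### The probability bounds for the exact and the noisy objective. -/

section Parts

variable {Ω : Type u} [MeasurableSpace Ω] {μ : Measure Ω} [IsProbabilityMeasure μ]

lemma IsSmooth.mono {k : ℕ} {β β' : ℝ} {G : Eu k → ℝ} (hG : IsSmooth β G) (h : β ≤ β') :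
    IsSmooth β' G :=
  ⟨hG.1, fun x y => (hG.2 x y).trans (by gcongr)⟩

lemma IsMonotoneTransformation.lt_iff_lt {E : Type*} {f g : E → ℝ}
    (h : IsMonotoneTransformation f g) (a b : E) : f a < f b ↔ g a < g b := by
  obtain ⟨φ, hφ, rfl⟩ := h
  exact hφ.lt_iff_lt (mem_range_self a) (mem_range_self b)

lemma IsMonotoneTransformation.le_iff_le {E : Type*} {f g : E → ℝ}
    (h : IsMonotoneTransformation f g) (a b : E) : f a ≤ f b ↔ g a ≤ g b := by
  rw [← not_lt, ← not_lt, h.lt_iff_lt]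

lemma projA_apply_self {n k : ℕ} (A : Eu k →ₗᵢ[ℝ] Eu n) (y : Eu k) : projA A (A y) = A y :=
  congrArg A (coordA_apply_self A y)

lemma measurable_comp_projA {n k : ℕ} {A : Eu k →ₗᵢ[ℝ] Eu n} {g : Eu n → ℝ}
    (hg : Differentiable ℝ fun y => g (A y)) : Measurable fun x => g (projA A x) :=
  (hg.continuous.comp (coordA A).continuous).measurable

lemma le_mul_of_ratio_le {α β Q : ℝ} (hα : 0 < α) (h : β / α ≤ Q) : β ≤ α * Q := by
  rwa [div_le_iff₀ hα, mul_comm] at h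

/-- After `E` epochs, the distance to the optimum in the column space of `A` is at most
`R₀ / 2 ^ E` with high probability. -/
theorem prob_norm_projA_le {n k K E : ℕ} {Q s R₀ : ℝ} (hk : 1 ≤ k) (hkn : k ≤ n) (hQ : 2 ≤ Q)
    (hs : 1 ≤ s) (hR₀ : 0 < R₀) (hK : 4 * Real.sqrt Q * (n / k) ≤ 2 ^ K) (hE : 1 ≤ E)
    {A : Eu k →ₗᵢ[ℝ] Eu n} {f g : Eu n → ℝ} {x₀ xstar : Eu n} (hf : ∀ x, f x = g (projA A x))
    (hg : RestrictedConditionNumberLE A g Q) (hx₀ : ‖x₀ - xstar‖ ≤ R₀)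
    (hmin : ∀ y, f xstar ≤ f y) {w : ℕ → ℤ → Ω → Eu n}
    (hw : IsGaussianSampling μ (1 / 20 / (n * Q)) w) :
    ENNReal.ofReal (1 - E * Real.exp (-(s * k * Q * Real.log Q))) ≤
      μ {ω | ‖projA A ((gldFast f K (gldEpoch epochConst s k Q) R₀ x₀ (fun t k => w t k ω)
        (gldEpoch epochConst s k Q * E)).point - xstar)‖ ≤ R₀ / 2 ^ E} := by
  obtain ⟨q, ⟨gt, α, β, hα, hβ, hmono, hconv, hsmooth, rfl⟩, hq⟩ := hg
  set Gt : Eu k → ℝ := fun y => gt (A y) with hGt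
  -- The run depends only on the order of the values, so f is replaced by this order-equivalent
  -- continuous objective, which fits the model with no noise.
  set f' : Eu n → ℝ := fun x => gt (projA A x) with hf'
  have hlt : ∀ a b, f a < f b ↔ f' a < f' b := fun a b => by
    rw [hf, hf]; exact hmono.lt_iff_lt _ _
  have hmin' : ∀ y, Gt (coordA A xstar) ≤ Gt y := by
    intro y
    have h := hmin (A y)
    rw [hf, hf, projA_apply_self] at h
    exact (hmono.le_iff_le _ _).1 h
  have S : IsNoisyConvex A f' Gt Gt (coordA A xstar) α Q 0 :=
    { one_le := hk
      le_dim := hkn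
      two_le := hQ
      alpha_pos := hα
      noise_nonneg := le_rfl
      measurable := measurable_comp_projA hconv.1
      convex := hconv
      smooth := hsmooth.mono (le_mul_of_ratio_le hα hq)
      order := fun _ _ => Iff.rfl
      isMin := hmin'
      ray := fun y _ h0 h1 => hconv.ray_le hα.le _ y h0 h1
      approx := fun x => by
        change |gt (projA A x) - gt (projA A x)| ≤ 0
        simp }
  refine S.prob_settled hw (x₀ := x₀) hR₀ hs hK ?_ hE fun ω hω => ?_
  · rw [← map_sub]
    exact (norm_coordA_le A _).trans hx₀
  rw [mem_ofPred_eq, gldFast_congr hlt, norm_projA_sub]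
  set x := (gldFast f' K (gldEpoch epochConst s k Q) R₀ x₀ (fun t k => w t k ω)
    (gldEpoch epochConst s k Q * E)).point
  have hgap : Gt (coordA A x) - Gt (coordA A xstar) ≤ α / 2 * (R₀ / 2 ^ E) ^ 2 := by
    rcases hω with h | ⟨xh, hle, hgap⟩
    · have h1 := h (coordA A x) (S.value_le_add x)
      rw [noiseFloor] at h1
      have : 0 ≤ α / 2 * (R₀ / 2 ^ E) ^ 2 := by positivity
      linarith
    · have h1 := S.value_le_add x
      have h2 := S.le_add xh
      linarith
  have h1 := hconv.le_sub_min hmin' (coordA A x)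
  have h2 : ‖coordA A x - coordA A xstar‖ ^ 2 ≤ (R₀ / 2 ^ E) ^ 2 :=
    le_of_mul_le_mul_left (h1.trans hgap) (by positivity)
  exact le_of_sq_le_sq h2 (by positivity)

lemma projA_id {n : ℕ} (x : Eu n) : projA LinearIsometry.id x = x :=
  projA_apply_self LinearIsometry.id x

/-- The full-rank case. -/
theorem prob_norm_sub_le {n E : ℕ} {Q s R₀ : ℝ} (hn : 1 ≤ n) (hQ : 2 ≤ Q)
    (hs : 1 ≤ s) (hR₀ : 0 < R₀) (hE : 1 ≤ E)
    {f : Eu n → ℝ} {x₀ xstar : Eu n} (hf : ConditionNumberLE f Q) (hx₀ : ‖x₀ - xstar‖ ≤ R₀)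
    (hmin : ∀ y, f xstar ≤ f y) {w : ℕ → ℤ → Ω → Eu n}
    (hw : IsGaussianSampling μ (1 / 20 / (n * Q)) w) :
    ENNReal.ofReal (1 - E * Real.exp (-(s * n * Q * Real.log Q))) ≤
      μ {ω | ‖(gldFast f (gldSweep Q) (gldEpoch epochConst s n Q) R₀ x₀ (fun t k => w t k ω)
        (gldEpoch epochConst s n Q * E)).point - xstar‖ ≤ R₀ / 2 ^ E} := by
  have hn' : (n : ℝ) ≠ 0 := by positivity
  have h := prob_norm_projA_le (A := (LinearIsometry.id : Eu n →ₗᵢ[ℝ] Eu n)) (g := f)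
    (K := gldSweep Q) hn le_rfl hQ hs hR₀
    (by rw [div_self hn', mul_one]; exact le_two_pow_gldSweep hQ) hE
    (fun x => by rw [projA_id]) hf hx₀ hmin hw
  simpa only [projA_id] using h

/-- The radius enters squared: with a = βR₀²/ε ≥ 2 and 2^E ≥ a, the left side is at most ε/(2a). -/
lemma div_two_pow_sq_le {R₀ β ε : ℝ} (hβ : 0 < β) (hε : 0 < ε) (h : 2 * ε ≤ β * R₀ ^ 2) :
    β / 2 * (R₀ / 2 ^ gldNumEpochs (β * R₀ ^ 2 / ε)) ^ 2 ≤ ε / 4 := by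
  set a := β * R₀ ^ 2 / ε with ha
  have ha2 : 2 ≤ a := by rw [ha, le_div_iff₀ hε]; exact h
  have hE := le_two_pow_gldNumEpochs ha2
  have h1 : a * a ≤ (2 ^ gldNumEpochs a) ^ 2 := by
    rw [← sq]; exact pow_le_pow_left₀ (by linarith) hE 2
  have h2 : β * R₀ ^ 2 = a * ε := by rw [ha]; field_simp
  rw [div_pow, ← mul_div_assoc, div_le_iff₀ (by positivity)]
  calc β / 2 * R₀ ^ 2 = a * ε / 2 := by rw [← h2]; ring
    _ ≤ ε / 4 * (a * a) := by nlinarith [mul_pos hε (by linarith : 0 < a)]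
    _ ≤ _ := by gcongr

/-- The almost low-rank case. -/
theorem prob_almost_lowRank {n k K : ℕ} {Q s R₀ ε β δ : ℝ} (hk : 1 ≤ k) (hkn : k ≤ n)
    (hQ : 2 ≤ Q) (hs : 1 ≤ s) (hδε : 60 * δ * k * Q < ε) (hβ : 0 < β) (hR₀ : 0 < R₀)
    (hε : 2 * ε ≤ β * R₀ ^ 2) (hK : 4 * Real.sqrt Q * (n / k) ≤ 2 ^ K)
    {A : Eu k →ₗᵢ[ℝ] Eu n} {f g h : Eu n → ℝ} {x₀ xstar z : Eu n}
    (hf : ∀ x, f x = g (projA A x) + h x) (hh : Measurable h) (hδ : ∀ x, |h x| ≤ δ)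
    (hg : RestrictedConditionNumberLE A g Q) (hgc : ConvexOn ℝ univ fun y => g (A y))
    (hgs : IsSmooth β fun y => g (A y)) (hx₀ : ‖x₀ - z‖ ≤ R₀)
    (hz : ∀ y, g (projA A z) ≤ g (projA A y)) (hmin : ∀ y, f xstar ≤ f y)
    {w : ℕ → ℤ → Ω → Eu n} (hw : IsGaussianSampling μ (1 / 20 / (n * Q)) w) :
    ENNReal.ofReal (1 - gldNumEpochs (β * R₀ ^ 2 / ε) *
        Real.exp (-(s * k * Q * Real.log Q))) ≤
      μ {ω | f (gldFast f K (gldEpoch epochConst s k Q) R₀ x₀ (fun t k => w t k ω)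
          (gldEpoch epochConst s k Q * gldNumEpochs (β * R₀ ^ 2 / ε))).point - f xstar ≤ ε ∧
        ∀ α : ℝ, 0 < α → IsStronglyConvex α (fun y => g (A y)) →
          ‖projA A ((gldFast f K (gldEpoch epochConst s k Q) R₀ x₀ (fun t k => w t k ω)
          (gldEpoch epochConst s k Q * gldNumEpochs (β * R₀ ^ 2 / ε))).point - xstar)‖ ^ 2 ≤
            4 * ε / α} := by
  obtain ⟨q, ⟨gt, α, β', hα, hβ', hmono, hconv, hsmooth, rfl⟩, hq⟩ := hg
  have hδ0 : 0 ≤ δ := (abs_nonneg _).trans (hδ z)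
  have hk' : (1 : ℝ) ≤ k := by exact_mod_cast hk
  have hkQ : 2 ≤ k * Q := by nlinarith only [hk', hQ]
  have hδkQ : 0 ≤ δ * (k * Q - 2) := mul_nonneg hδ0 (by linarith)
  have hε0 : 0 < ε := by
    refine lt_of_le_of_lt ?_ hδε
    positivity
  set G : Eu k → ℝ := fun y => g (A y) with hG
  set Gt : Eu k → ℝ := fun y => gt (A y) with hGt
  have hGz : ∀ y, G (coordA A z) ≤ G y := by
    intro y
    have := hz (A y)
    rwa [projA_apply_self] at this
  have S : IsNoisyConvex A f G Gt (coordA A z) α Q δ :=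
    { one_le := hk
      le_dim := hkn
      two_le := hQ
      alpha_pos := hα
      noise_nonneg := hδ0
      measurable := by
        rw [funext hf]
        exact (measurable_comp_projA hgs.1).add hh
      convex := hconv
      smooth := hsmooth.mono (le_mul_of_ratio_le hα hq)
      order := fun _ _ => hmono.le_iff_le _ _
      isMin := hGz
      ray := fun y t h0 h1 => by
        have := hgc.2 (mem_univ (coordA A z)) (mem_univ y) (sub_nonneg.2 h1) h0 (by ring)
        have e : (1 - t) • coordA A z + t • y = coordA A z + t • (y - coordA A z) := by module
        rw [e] at this
        simp only [smul_eq_mul] at this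
        change G _ ≤ (1 - t) * G (coordA A z) + t * G y at this
        linarith
      approx := fun x => by
        have : f x - G (coordA A x) = h x := by rw [hf]; exact add_sub_cancel_left _ _
        rw [this]; exact hδ x }
  have ha2 : 2 ≤ β * R₀ ^ 2 / ε := by rw [le_div_iff₀ hε0]; exact hε
  refine S.prob_settled hw (x₀ := x₀) hR₀ hs hK ?_ (one_le_gldNumEpochs ha2) fun ω hω => ?_
  · rw [← map_sub]
    exact (norm_coordA_le A _).trans hx₀
  have hsq := div_two_pow_sq_le hβ hε0 hε
  set E := gldNumEpochs (β * R₀ ^ 2 / ε)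
  rw [mem_ofPred_eq]
  set x := (gldFast f K (gldEpoch epochConst s k Q) R₀ x₀ (fun t k => w t k ω)
    (gldEpoch epochConst s k Q * E)).point
  have hs1 := S.value_le_add xstar
  have hs2 := S.value_le_add x
  have hs3 := S.le_add z
  have hs4 := hmin z
  have hs5 := hGz (coordA A xstar)
  have hval : f x - f xstar ≤ ε := by
    rcases hω with hd | ⟨xh, hle, hgap⟩
    -- Within the noise the error is at most the noise floor plus 2δ, that is 50δkQ + 4δ ≤ 52δkQ.
    · have h1 := hd (coordA A x) hs2
      rw [noiseFloor] at h1
      have h2 := S.le_add x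
      linarith
    -- Strong convexity of `Gt` turns the gap at xh into a distance, and smoothness of G turns this
    -- into a gap of G; the error is at most ε/4 + 2δ.
    · have h1 := S.le_add xh
      have h2 := hgs.sub_min_le hGz (coordA A xh)
      have h3 := hconv.le_sub_min S.isMin_gt (coordA A xh)
      have h4 : ‖coordA A xh - coordA A z‖ ^ 2 ≤ (R₀ / 2 ^ E) ^ 2 :=
        le_of_mul_le_mul_left (h3.trans hgap) (by positivity)
      have h5 : β / 2 * ‖coordA A xh - coordA A z‖ ^ 2 ≤ β / 2 * (R₀ / 2 ^ E) ^ 2 := by gcongr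
      linarith
  refine ⟨hval, fun α' hα' hsc => ?_⟩
  rw [norm_projA_sub, le_div_iff₀ hα']
  have h1 := hsc.le_sub_min hGz (coordA A x)
  have h2 := hsc.le_sub_min hGz (coordA A xstar)
  have htri : ‖coordA A x - coordA A xstar‖ ≤
      ‖coordA A x - coordA A z‖ + ‖coordA A xstar - coordA A z‖ := by
    rw [norm_sub_rev (coordA A xstar)]
    exact norm_sub_le_norm_sub_add_norm_sub _ _ _
  set p := ‖coordA A x - coordA A z‖
  set r := ‖coordA A xstar - coordA A z‖
  -- The gaps of G are at most ε + 2δ at x and 2δ at xstar, so these weights give 3ε + 18δ ≤ 4ε;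
  -- equal weights would overshoot 4ε.
  have hpr : ‖coordA A x - coordA A xstar‖ ^ 2 ≤ 3 / 2 * p ^ 2 + 3 * r ^ 2 := by
    calc _ ≤ (p + r) ^ 2 := pow_le_pow_left₀ (norm_nonneg _) htri 2
      _ ≤ _ := by nlinarith only [sq_nonneg (p - 2 * r)]
  have h3 : ‖coordA A x - coordA A xstar‖ ^ 2 * α' ≤ (3 / 2 * p ^ 2 + 3 * r ^ 2) * α' := by
    gcongr
  linarith

end Parts

/-! ### From the diameter and the parameters to the stated bounds. -/

section Final

lemma norm_sub_le_diam {n : ℕ} {X : Set (Eu n)} (hX : IsCompact X) {x y : Eu n} (hx : x ∈ X)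
    (hy : y ∈ X) : ‖x - y‖ ≤ Metric.diam X := by
  rw [← dist_eq_norm]
  exact Metric.dist_le_diam_of_mem hX.isBounded hx hy

lemma one_le_of_diam_pos {n : ℕ} {X : Set (Eu n)} (h : 0 < Metric.diam X) : 1 ≤ n := by
  rcases Nat.eq_zero_or_pos n with rfl | hn
  · rw [Metric.diam_subsingleton Set.subsingleton_of_subsingleton] at h
    exact absurd h (lt_irrefl _)
  · exact hn

lemma diam_pos_of_le {n : ℕ} {X : Set (Eu n)} {β ε : ℝ} (hε : 0 < ε)
    (h : 2 * ε ≤ β * Metric.diam X ^ 2) : 0 < Metric.diam X := by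
  refine lt_of_le_of_ne Metric.diam_nonneg fun h0 => ?_
  rw [← h0] at h
  linarith

/-- Since n/k ≤ n, a sweep sized by n works for every k. -/
lemma sweepLowRank_covers {n k : ℕ} {Q : ℝ} (hk : 1 ≤ k) (hn : 1 ≤ n) (hQ : 2 ≤ Q) :
    4 * Real.sqrt Q * (n / k) ≤ 2 ^ gldSweepLowRank n Q := by
  have hk' : (1 : ℝ) ≤ k := by exact_mod_cast hk
  calc 4 * Real.sqrt Q * (n / k) ≤ 4 * Real.sqrt Q * n := by
        gcongr
        exact div_le_self (by positivity) hk'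
    _ = 4 * n * Real.sqrt Q := by ring
    _ ≤ _ := le_two_pow_gldSweepLowRank hn hQ

lemma div_two_pow_gldNumEpochs_le {R₀ ε : ℝ} (hε : 0 < ε) (h : 2 * ε ≤ R₀) :
    R₀ / 2 ^ gldNumEpochs (R₀ / ε) ≤ ε := by
  have := le_two_pow_gldNumEpochs ((le_div_iff₀ hε).2 h)
  rw [div_le_iff₀ hε] at this
  rw [div_le_iff₀ (by positivity)]
  linarith

end Final

theorem mainTheorem6 :
    ∃ c C₁ C : ℝ, 0 < c ∧ 0 < C₁ ∧ 0 < C ∧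
    -- full rank: distance to the optimum
    (∀ (n : ℕ) (Q s ε : ℝ) (X : Set (Eu n)),
      2 ≤ Q → 1 ≤ s → 0 < ε → IsCompact X → 2 * ε ≤ Metric.diam X →
      ∀ (f : Eu n → ℝ) (x₀ xstar : Eu n),
      ConditionNumberLE f Q → x₀ ∈ X → xstar ∈ X → (∀ y, f xstar ≤ f y) →
      ∀ (Ω : Type u) [MeasurableSpace Ω] (μ : Measure Ω) [IsProbabilityMeasure μ]
        (w : ℕ → ℤ → Ω → Eu n),
      IsGaussianSampling μ (c / (n * Q)) w →
      let H := gldEpoch C₁ s n Q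
      let E := gldNumEpochs (Metric.diam X / ε)
      let out : Ω → GLDState n := fun ω =>
        gldFast f (gldSweep Q) H (Metric.diam X) x₀ (fun t k => w t k ω) (H * E)
      (∀ ω, ((out ω).evals : ℝ) ≤
        C * s * (n * Q * Real.log Q ^ 2 * Real.log (Metric.diam X / ε))) ∧
      ENNReal.ofReal (1 - E * Real.exp (-(s * n * Q * Real.log Q))) ≤
        μ {ω | ‖(out ω).point - xstar‖ ≤ ε}) ∧
    -- full rank: function value
    (∀ (n : ℕ) (Q s ε β : ℝ) (X : Set (Eu n)),
      2 ≤ Q → 1 ≤ s → 0 < ε → 0 < β → IsCompact X → 2 * ε ≤ β * Metric.diam X ^ 2 →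
      ∀ (f : Eu n → ℝ) (x₀ xstar : Eu n),
      ConditionNumberLE f Q → IsSmooth β f → x₀ ∈ X → xstar ∈ X → (∀ y, f xstar ≤ f y) →
      ∀ (Ω : Type u) [MeasurableSpace Ω] (μ : Measure Ω) [IsProbabilityMeasure μ]
        (w : ℕ → ℤ → Ω → Eu n),
      IsGaussianSampling μ (c / (n * Q)) w →
      let H := gldEpoch C₁ s n Q
      let E := gldNumEpochs (β * Metric.diam X ^ 2 / ε)
      let out : Ω → GLDState n := fun ω =>
        gldFast f (gldSweep Q) H (Metric.diam X) x₀ (fun t k => w t k ω) (H * E)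
      (∀ ω, ((out ω).evals : ℝ) ≤
        C * s * (n * Q * Real.log Q ^ 2 * Real.log (β * Metric.diam X ^ 2 / ε))) ∧
      ENNReal.ofReal (1 - E * Real.exp (-(s * n * Q * Real.log Q))) ≤
        μ {ω | f (out ω).point - f xstar ≤ ε}) ∧
    -- low rank
    (∀ (n k : ℕ) (Q s ε : ℝ) (X : Set (Eu n)),
      1 ≤ k → k < n → 2 ≤ Q → 1 ≤ s → 0 < ε → IsCompact X → 2 * ε ≤ Metric.diam X →
      ∀ (A : Eu k →ₗᵢ[ℝ] Eu n) (f g : Eu n → ℝ) (x₀ xstar : Eu n),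
      (∀ x, f x = g (projA A x)) → RestrictedConditionNumberLE A g Q →
      x₀ ∈ X → xstar ∈ X → (∀ y, f xstar ≤ f y) →
      ∀ (Ω : Type u) [MeasurableSpace Ω] (μ : Measure Ω) [IsProbabilityMeasure μ]
        (w : ℕ → ℤ → Ω → Eu n),
      IsGaussianSampling μ (c / (n * Q)) w →
      let H := gldEpoch C₁ s k Q
      let E := gldNumEpochs (Metric.diam X / ε)
      let out : Ω → GLDState n := fun ω =>
        gldFast f (gldSweepLowRank n Q) H (Metric.diam X) x₀ (fun t k => w t k ω) (H * E)
      (∀ ω, ((out ω).evals : ℝ) ≤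
        C * s * (k * Q * Real.log n * Real.log Q ^ 2 * Real.log (Metric.diam X / ε))) ∧
      ENNReal.ofReal (1 - E * Real.exp (-(s * k * Q * Real.log Q))) ≤
        μ {ω | ‖projA A ((out ω).point - xstar)‖ ≤ ε}) ∧
    -- almost low rank
    (∀ (n k : ℕ) (Q s ε β δ : ℝ) (X : Set (Eu n)),
      1 ≤ k → k < n → 2 ≤ Q → 1 ≤ s → 60 * δ * k * Q < ε → 0 < β → IsCompact X →
      2 * ε ≤ β * Metric.diam X ^ 2 →
      ∀ (A : Eu k →ₗᵢ[ℝ] Eu n) (f g h : Eu n → ℝ) (x₀ xstar z : Eu n),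
      (∀ x, f x = g (projA A x) + h x) → Measurable h → (∀ x, |h x| ≤ δ) →
      RestrictedConditionNumberLE A g Q → ConvexOn ℝ univ (fun y => g (A y)) →
      IsSmooth β (fun y => g (A y)) →
      x₀ ∈ X → z ∈ X → (∀ y, g (projA A z) ≤ g (projA A y)) → (∀ y, f xstar ≤ f y) →
      ∀ (Ω : Type u) [MeasurableSpace Ω] (μ : Measure Ω) [IsProbabilityMeasure μ]
        (w : ℕ → ℤ → Ω → Eu n),
      IsGaussianSampling μ (c / (n * Q)) w →
      let H := gldEpoch C₁ s k Q
      let E := gldNumEpochs (β * Metric.diam X ^ 2 / ε)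
      let out : Ω → GLDState n := fun ω =>
        gldFast f (gldSweepLowRank n Q) H (Metric.diam X) x₀ (fun t k => w t k ω) (H * E)
      (∀ ω, ((out ω).evals : ℝ) ≤
        C * s * (k * Q * Real.log n * Real.log Q ^ 2 *
          Real.log (β * Metric.diam X ^ 2 / ε))) ∧
      ENNReal.ofReal (1 - E * Real.exp (-(s * k * Q * Real.log Q))) ≤
        μ {ω | f (out ω).point - f xstar ≤ ε ∧
          ∀ α : ℝ, 0 < α → IsStronglyConvex α (fun y => g (A y)) →
            ‖projA A ((out ω).point - xstar)‖ ^ 2 ≤ 4 * ε / α}) := by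
  have hC1 := one_le_epochConst
  refine ⟨1 / 20, epochConst, 352 * epochConst, by norm_num, by linarith, by linarith,
    ?_, ?_, ?_, ?_⟩
  · intro n Q s ε X hQ hs hε hX hεX f x₀ xstar hf hx₀ hxs hmin Ω _ μ _ w hw H E out
    have hR₀ : 0 < Metric.diam X := by linarith
    have ha : 2 ≤ Metric.diam X / ε := (le_div_iff₀ hε).2 hεX
    have hn := one_le_of_diam_pos hR₀
    constructor
    · intro ω
      refine (gldFast_evals_le hn hs hQ ha (two_mul_gldSweep_add_two_le hQ) f _ x₀ _).trans
        (le_of_eq ?_)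
      ring
    · refine (prob_norm_sub_le hn hQ hs hR₀ (one_le_gldNumEpochs ha) hf
        (norm_sub_le_diam hX hx₀ hxs) hmin hw).trans (measure_mono fun ω hω => ?_)
      exact (id hω : _ ≤ Metric.diam X / 2 ^ gldNumEpochs (Metric.diam X / ε)).trans
        (div_two_pow_gldNumEpochs_le hε hεX)
  · intro n Q s ε β X hQ hs hε hβ hX hεX f x₀ xstar hf hfs hx₀ hxs hmin Ω _ μ _ w hw H E out
    have hR₀ := diam_pos_of_le hε hεX
    have ha : 2 ≤ β * Metric.diam X ^ 2 / ε := (le_div_iff₀ hε).2 hεX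
    have hn := one_le_of_diam_pos hR₀
    constructor
    · intro ω
      refine (gldFast_evals_le hn hs hQ ha (two_mul_gldSweep_add_two_le hQ) f _ x₀ _).trans
        (le_of_eq ?_)
      ring
    · refine (prob_norm_sub_le hn hQ hs hR₀ (one_le_gldNumEpochs ha) hf
        (norm_sub_le_diam hX hx₀ hxs) hmin hw).trans (measure_mono fun ω hω => ?_)
      -- Smoothness converts the distance bound, run with this larger argument of the logarithm,
      -- into a gap of at most ε/4.
      have h1 := hfs.sub_min_le hmin (out ω).point
      have h2 : ‖(out ω).point - xstar‖ ^ 2 ≤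
          (Metric.diam X / 2 ^ gldNumEpochs (β * Metric.diam X ^ 2 / ε)) ^ 2 :=
        pow_le_pow_left₀ (norm_nonneg _) hω 2
      have h3 := div_two_pow_sq_le hβ hε hεX
      have h4 := mul_le_mul_of_nonneg_left h2 (by positivity : 0 ≤ β / 2)
      change f (out ω).point - f xstar ≤ ε
      linarith
  · intro n k Q s ε X hk hkn hQ hs hε hX hεX A f g x₀ xstar hf hg hx₀ hxs hmin Ω _ μ _ w hw
      H E out
    have hR₀ : 0 < Metric.diam X := by linarith
    have ha : 2 ≤ Metric.diam X / ε := (le_div_iff₀ hε).2 hεX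
    constructor
    · intro ω
      refine (gldFast_evals_le hk hs hQ ha (two_mul_gldSweepLowRank_add_two_le (by omega) hQ)
        f _ x₀ _).trans (le_of_eq ?_)
      ring
    · refine (prob_norm_projA_le hk hkn.le hQ hs hR₀ (sweepLowRank_covers hk (by omega) hQ)
        (one_le_gldNumEpochs ha) hf hg (norm_sub_le_diam hX hx₀ hxs) hmin hw).trans
        (measure_mono fun ω hω => ?_)
      exact (id hω : _ ≤ Metric.diam X / 2 ^ gldNumEpochs (Metric.diam X / ε)).trans
        (div_two_pow_gldNumEpochs_le hε hεX)
  · intro n k Q s ε β δ X hk hkn hQ hs hδε hβ hX hεX A f g h x₀ xstar z hf hh hδ hg hgc hgs hx₀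
      hzX hz hmin Ω _ μ _ w hw H E out
    have hδ0 : 0 ≤ δ := (abs_nonneg _).trans (hδ z)
    have hε : 0 < ε := lt_of_le_of_lt (by positivity) hδε
    have hR₀ := diam_pos_of_le hε hεX
    have ha : 2 ≤ β * Metric.diam X ^ 2 / ε := (le_div_iff₀ hε).2 hεX
    constructor
    · intro ω
      refine (gldFast_evals_le hk hs hQ ha (two_mul_gldSweepLowRank_add_two_le (by omega) hQ)
        f _ x₀ _).trans (le_of_eq ?_)
      ring
    · exact prob_almost_lowRank hk hkn.le hQ hs hδε hβ hR₀ hεX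
        (sweepLowRank_covers hk (by omega) hQ) hf hh hδ hg hgc hgs
        (norm_sub_le_diam hX hx₀ hzX) hz hmin hw
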